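/- Let $q\in\mathbf C$ with $|q|>1$, let $K=\mathbf C((z))$, and let $\sigma_q$ be the automorphism $f(z)\mapsto f(qz)$ of $K$. Fix a family $(q_l)_{l\ge 1}$ of complex numbers with $q_l^{\,l}=q$ and $q_{lm}^{\,l}=q_m$ for all $l,m\ge 1$. For $l\ge 1$ let $K_l=\mathbf C((z_l))$ with $z_l^{\,l}=z$, with the $z_l$-adic valuation $v$ and the automorphism $\sigma_{q_l}:f(z_l)\mapsto f(q_lz_l)$, which extends $\sigma_q$. A $q$-difference module over $K$ is a pair $(M,\Phi)$, where $M$ is a finite-dimensional $K$-vector space and $\Phi$ is a $\sigma_q$-linear automorphism of $M$; its rank is $\dim_K M$, and its submodules are the subspaces stable under $\Phi$ and $\Phi^{-1}$. Its Newton function $r_M:\mathbf Q\to\mathbf N$ is obtained as follows. For a suitable $l\ge 1$, the module $(K_l\otimes_K M,\ \sigma_{q_l}\otimes\Phi)$ has a basis $(b_1,\dots,b_n)$ over $K_l$ and elements $a_1,\dots,a_n\in K_l^*$ such that $\sigma_{q_l}\otimes\Phi$ sends $b_j$ to $a_jb_j$ plus an element of the span of $b_1,\dots,b_{j-1}$,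 for every $j$; then $r_M(\mu)$ is the number of indices $j$ with $v(a_j)/l=\mu$ (this does not depend on the choices). The set of slopes $S(M)$ of $M$ is the support of $r_M$, and $M$ is pure of slope $\mu$ if $S(M)=\{\mu\}$. **Theorem.** Let $M$ be a $q$-difference module over $K=\mathbf C((z))$. Then $S(M)$ is a finite set, $S(M)=\{\mu_1,\dots,\mu_k\}$ with the $\mu_i$ pairwise distinct, and $M$ has a unique decomposition as a direct sum of pure submodules with pairwise distinct slopes. The slopes of the summands are exactly $\mu_1,\dots,\mu_k$, and the summand of slope $\mu_i$ has rank $r_M(\mu_i)$. Uniqueness means that every decomposition of $M$ as a direct sum of pure submodules with pairwise distinct slopes coincides with this one, up to the order of the summands. -/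

import Mathlib

open scoped TensorProduct

noncomputable section

namespace QDiff

universe u v

/-! ### Difference fields -/

/-- The field `ℂ((z))` of formal Laurent series. -/
abbrev K : Type := LaurentSeries ℂ

/-- The ring endomorphism `f(z) ↦ f(q z)` of `ℂ((z))`. -/
def sigmaHom (q : ℂˣ) : K →+* K where
  toFun f :=
    { coeff := fun n => ((q ^ n : ℂˣ) : ℂ) * f.coeff n
      isPWO_support' := f.isPWO_support.mono fun n hn => by
        simp only [Function.mem_support] at hn
        exact right_ne_zero_of_mul hn }
  map_zero' := by ext n; simp
  map_add' f g := by ext n; simp [mul_add]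
  map_one' := by
    ext n
    by_cases h : n = 0
    · subst h; simp
    · simp [HahnSeries.coeff_one, h]
  map_mul' f g := by
    ext n
    simp only [HahnSeries.coeff_mul, Finset.mul_sum]
    have key : ∀ h : K, (∀ k, h.coeff k = ((q ^ k : ℂˣ) : ℂ) * f.coeff k) →
        ∀ h' : K, (∀ k, h'.coeff k = ((q ^ k : ℂˣ) : ℂ) * g.coeff k) →
        ∑ x ∈ Finset.antidiagonal f.isPWO_support g.isPWO_support n,
          ((q ^ n : ℂˣ) : ℂ) * (f.coeff x.1 * g.coeff x.2) =
        ∑ x ∈ Finset.antidiagonal h.isPWO_support h'.isPWO_support n,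
          h.coeff x.1 * h'.coeff x.2 := by
      intro h hh h' hh'
      refine Finset.sum_congr ?_ ?_
      · ext x
        simp [Finset.mem_antidiagonal, hh, hh', zpow_ne_zero]
      · intro x hx
        rw [Finset.mem_antidiagonal] at hx
        rw [hh, hh', ← hx.2.2, zpow_add, Units.val_mul]
        ring
    exact key _ (fun _ => rfl) _ (fun _ => rfl)

/-- The automorphism `σ_q : f(z) ↦ f(q z)` of `ℂ((z))`, i.e. `∑ aₙ zⁿ ↦ ∑ qⁿ aₙ zⁿ`. -/
def sigma (q : ℂˣ) : K ≃+* K :=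
  RingEquiv.ofRingHom (sigmaHom q) (sigmaHom q⁻¹)
    (by ext f n; simp [sigmaHom, zpow_ne_zero]) (by ext f n; simp [sigmaHom, zpow_ne_zero])

/-- A compatible family of roots of `q`: `(q_l)^l = q` and `(q_{lm})^l = q_m`. -/
structure RootSystem (q : ℂˣ) where
  root : ℕ+ → ℂˣ
  root_pow : ∀ l : ℕ+, root l ^ (l : ℕ) = q
  root_mul_pow : ∀ l m : ℕ+, root (l * m) ^ (l : ℕ) = root m

/-- Substitution `z ↦ z_l ^ l`, from `ℂ((z))` to `ℂ((z_l))`. -/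
def ramify (l : ℕ+) : K →+* K :=
  HahnSeries.embDomainRingHom (AddMonoidHom.mulLeft ((l : ℕ) : ℤ))
    (fun _ _ h => mul_left_cancel₀ (by simp) h)
    (fun _ _ => mul_le_mul_iff_right₀ (by simp))

/-- The ramified extension `K_l = ℂ((z_l))` of `K = ℂ((z))`, where `z_l ^ l = z`. -/
def Ramified (_ : ℕ+) : Type := K

instance (l : ℕ+) : Field (Ramified l) := inferInstanceAs (Field K)

instance (l : ℕ+) : Algebra K (Ramified l) := (ramify l).toAlgebra

/-- The `z_l`-adic valuation of a nonzero element of `K_l`. -/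
def val (l : ℕ+) (a : Ramified l) : ℤ := HahnSeries.order (Γ := ℤ) (R := ℂ) a

/-- The automorphism `f(z_l) ↦ f(q_l z_l)` of `K_l`. -/
def sigmaRam {q : ℂˣ} (ρ : RootSystem q) (l : ℕ+) : Ramified l ≃+* Ramified l :=
  (sigma (ρ.root l) : K ≃+* K)

/-- The automorphism of `K_l` extends the one of `K`. -/
theorem sigma_ramify {q : ℂˣ} (ρ : RootSystem q) (l : ℕ+) (f : K) :
    sigma (ρ.root l) (ramify l f) = ramify l (sigma q f) := by
  ext n
  change ((ρ.root l ^ n : ℂˣ) : ℂ) * (ramify l f).coeff n = _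
  have hco : ∀ (g : K) (m : ℤ), (ramify l g).coeff (((l : ℕ) : ℤ) * m) = g.coeff m :=
    fun g m => HahnSeries.embDomain_coeff
  by_cases h : ∃ m : ℤ, ((l : ℕ) : ℤ) * m = n
  · obtain ⟨m, rfl⟩ := h
    rw [hco, hco, zpow_mul, zpow_natCast, ρ.root_pow]
    rfl
  · have hz : ∀ g : K, (ramify l g).coeff n = 0 := by
      intro g
      apply HahnSeries.embDomain_of_notMem_range
      rintro ⟨m, hm⟩
      exact h ⟨m, hm⟩
    rw [hz, hz, mul_zero]

/-! ### Difference modules -/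

/-- A difference module over the difference field `(F, σ)`: a vector space `M` (of finite
dimension, wherever it is used below) with a `σ`-linear automorphism `Φ`. -/
structure DiffModule (F : Type u) [Field F] (σ : F ≃+* F) (M : Type v)
    [AddCommGroup M] [Module F M] where
  Φ : M →ₛₗ[(σ : F →+* F)] M
  bijective : Function.Bijective Φ

namespace DiffModule

section General

variable {F : Type u} [Field F] {σ : F ≃+* F} {M : Type v} [AddCommGroup M] [Module F M]

/-- `N` is a difference submodule: a subspace stable under `Φ` and `Φ⁻¹`. -/
def IsStable (S : DiffModule F σ M) (N : Submodule F M) : Prop :=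
  ∀ x, S.Φ x ∈ N ↔ x ∈ N

/-- A difference submodule as a difference module. -/
def restrict (S : DiffModule F σ M) (N : Submodule F M) (hN : S.IsStable N) :
    DiffModule F σ N where
  Φ := S.Φ.restrict fun x hx => (hN x).2 hx
  bijective := by
    constructor
    · intro x y h
      exact Subtype.ext (S.bijective.1 (congrArg Subtype.val h))
    · rintro ⟨y, hy⟩
      obtain ⟨x, rfl⟩ := S.bijective.2 y
      exact ⟨⟨x, (hN x).1 hy⟩, rfl⟩

/-- In the basis `b`, the automorphism `Φ` is upper triangular with diagonal entries `a j`.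
The subspaces spanned by `b 0, …, b (j - 1)` then form a complete flag of difference
submodules, and the `j`-th quotient has rank one with a generator `e` such that
`Φ e = a j • e`, i.e. it is isomorphic to `D / D (σ - a j)`. -/
def IsTriangular (S : DiffModule F σ M) {n : ℕ} (b : Module.Basis (Fin n) F M)
    (a : Fin n → F) : Prop :=
  ∀ j, a j ≠ 0 ∧ S.Φ (b j) - a j • b j ∈ Submodule.span F (b '' Set.Iio j)

end General

section Ramification

variable {q : ℂˣ} {M : Type v} [AddCommGroup M] [Module K M]

/-- The map `σ_{q_l} : K_l → K_l`, as a `σ_q`-linear map of `K`-vector spaces. -/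
def sigmaRamLin (ρ : RootSystem q) (l : ℕ+) :
    Ramified l →ₛₗ[(sigma q : K →+* K)] Ramified l where
  toFun := sigmaRam ρ l
  map_add' := map_add _
  map_smul' c x := by
    rw [Algebra.smul_def, Algebra.smul_def, map_mul]
    congr 1
    exact sigma_ramify ρ l c

/-- The inverse of `σ_{q_l}`, as a `σ_q⁻¹`-linear map of `K`-vector spaces. -/
def sigmaRamLinSymm (ρ : RootSystem q) (l : ℕ+) :
    Ramified l →ₛₗ[((sigma q).symm : K →+* K)] Ramified l where
  toFun := (sigmaRam ρ l).symm
  map_add' := map_add _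
  map_smul' c x := by
    apply (sigmaRam ρ l).injective
    have h := (sigmaRamLin ρ l).map_smulₛₗ ((sigma q).symm c) ((sigmaRam ρ l).symm x)
    have h' : ((sigma q : K →+* K)) ((sigma q).symm c) = c := (sigma q).apply_symm_apply c
    have h'' : sigmaRamLin ρ l ((sigmaRam ρ l).symm x) = x := (sigmaRam ρ l).apply_symm_apply x
    rw [h', h''] at h
    exact ((sigmaRam ρ l).apply_symm_apply _).trans h.symm

attribute [local instance] RingHomInvPair.of_ringEquiv RingHomInvPair.of_ringEquiv_symm

/-- `Φ` as a semilinear equivalence. -/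
def equiv (S : DiffModule K (sigma q) M) : M ≃ₛₗ[(sigma q : K →+* K)] M :=
  LinearEquiv.ofBijective S.Φ S.bijective

/-- Extension of scalars along the ramification: the module `K_l ⊗_K M` over
`(K_l, σ_{q_l})`, with the automorphism `σ_{q_l} ⊗ Φ`. -/
def baseChange (S : DiffModule K (sigma q) M) (ρ : RootSystem q) (l : ℕ+) :
    DiffModule (Ramified l) (sigmaRam ρ l) (Ramified l ⊗[K] M) where
  Φ :=
    { toFun := TensorProduct.map (sigmaRamLin ρ l) S.Φ
      map_add' := map_add _
      map_smul' := by
        intro c x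
        induction x with
        | zero => simp
        | add x y hx hy => rw [smul_add, map_add, map_add, smul_add, hx, hy]
        | tmul x m =>
          rw [TensorProduct.smul_tmul', TensorProduct.map_tmul, TensorProduct.map_tmul,
            TensorProduct.smul_tmul']
          congr 1
          exact map_mul (sigmaRam ρ l) c x }
  bijective := by
    have h₁ : ∀ x, TensorProduct.map (sigmaRamLinSymm ρ l) (S.equiv.symm : M →ₛₗ[_] M)
        (TensorProduct.map (sigmaRamLin ρ l) S.Φ x) = x := by
      intro x
      induction x with
      | zero => simp
      | add x y hx hy => rw [map_add, map_add, hx, hy]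
      | tmul x m =>
        rw [TensorProduct.map_tmul, TensorProduct.map_tmul]
        congr 1
        · exact (sigmaRam ρ l).symm_apply_apply x
        · exact S.equiv.symm_apply_apply m
    have h₂ : ∀ x, TensorProduct.map (sigmaRamLin ρ l) S.Φ
        (TensorProduct.map (sigmaRamLinSymm ρ l) (S.equiv.symm : M →ₛₗ[_] M) x) = x := by
      intro x
      induction x with
      | zero => simp
      | add x y hx hy => rw [map_add, map_add, hx, hy]
      | tmul x m =>
        rw [TensorProduct.map_tmul, TensorProduct.map_tmul]
        congr 1
        · exact (sigmaRam ρ l).apply_symm_apply x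
        · exact S.equiv.apply_symm_apply m
    exact Function.bijective_iff_has_inverse.2 ⟨_, h₁, h₂⟩

/-! ### Newton function and slopes -/

/-- `r` is computed by triangularizing `M` over some `K_l`: `r μ` is the number of rank one
constituents `D / D (σ - a)` of `K_l ⊗_K M` with `v(a) / l = μ`. -/
def HasNewtonFunction (S : DiffModule K (sigma q) M) (ρ : RootSystem q) (r : ℚ → ℕ) : Prop :=
  ∃ (l : ℕ+) (n : ℕ) (b : Module.Basis (Fin n) (Ramified l) (Ramified l ⊗[K] M))
    (a : Fin n → Ramified l), (S.baseChange ρ l).IsTriangular b a ∧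
      ∀ μ : ℚ, r μ = Nat.card {j : Fin n // (val l (a j) : ℚ) / ((l : ℕ) : ℚ) = μ}

open Classical in
/-- The Newton function `r_M : ℚ → ℕ` of a `q`-difference module `M` over `ℂ((z))`. (Every
`q`-difference module has exactly one, if `q` is not a root of unity.) -/
def newtonFunction (S : DiffModule K (sigma q) M) (ρ : RootSystem q) : ℚ → ℕ :=
  if h : ∃ r, S.HasNewtonFunction ρ r then h.choose else 0

/-- The set `S(M)` of slopes: the support of the Newton function. -/
def slopes (S : DiffModule K (sigma q) M) (ρ : RootSystem q) : Set ℚ :=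
  Function.support (S.newtonFunction ρ)

/-- `M` is pure of slope `μ`: `S(M) = {μ}`. -/
def IsPure (S : DiffModule K (sigma q) M) (ρ : RootSystem q) (μ : ℚ) : Prop :=
  S.slopes ρ = {μ}

/-- `M` is the direct sum of the `N i`, each `N i` is a difference submodule which is pure of
slope `μ i`, and these slopes are pairwise distinct. -/
structure IsPureDecomposition (S : DiffModule K (sigma q) M) (ρ : RootSystem q) {ι : Type}
    (μ : ι → ℚ) (N : ι → Submodule K M) : Prop where
  injective : Function.Injective μ
  stable : ∀ i, S.IsStable (N i)
  pure : ∀ i, (S.restrict (N i) (stable i)).IsPure ρ (μ i)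
  independent : iSupIndep N
  iSup_eq_top : ⨆ i, N i = ⊤

end Ramification

end DiffModule

end QDiff

end

/-! Slopes are detected by growth. With the absolute value `exp (-ord_z f)`, which is invariant
under `σ`, the slope part of `M` for `μ` consists of the vectors `x` such that the coordinates of
`Φⁿ x` are `O(rⁿ)` for all integers `n`, where `r = exp (-μ)`. This is a stable subspace defined
over `K` without any choice, and the theorem follows once these parts are shown to decompose `M`
with dimensions `r_M(μ)`.

Over `K_l`, take a triangular basis with diagonal `a_j`. The last nonzero coordinate along an orbit
is multiplied by `|a_j|` at each step, so the part of growth `r` has dimension at most the number of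
`j` with `|a_j| = r` (`IsTriangular.finrank_slopePart_le`). Conversely, `a σ(h) - c h = f` is
solvable when `|a| ≠ |c|`, so each `b_j` can be corrected by earlier basis vectors to lie in the
part of growth `|a_j|`, and the parts span (`IsTriangular.mem_iSup_slopePart`).

Both facts pass to `K`. The inclusion `x ↦ 1 ⊗ x` preserves slope parts, which gives the upper bound
on dimensions; keeping only the powers of `z` in a series in `z_l` gives a `Φ`-equivariant
retraction that does not increase absolute values, which gives spanning. As the bounds add up to
`dim M`, they are equalities and the sum is direct (`finrank_eq_and_iSupIndep_of_le`).

A triangular basis exists (`exists_isTriangular`) because, after ramification, a cyclic submodule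
has an eigenvector: a Newton polygon argument reduces this to a power series equation, solvable
without resonance because `|q| > 1`. Finally, a pure submodule of slope `μ` lies in the part of
slope `μ`, whence uniqueness. -/

noncomputable section

namespace QDiff

universe u v

/-! ### Invariant absolute values and geometric growth -/

/-- A non-archimedean absolute value on a difference field, invariant under the automorphism. -/
structure InvariantAbs {F : Type u} [Field F] (σ : F ≃+* F) where
  abs : AbsoluteValue F ℝ
  nonarch : ∀ x y, abs (x + y) ≤ max (abs x) (abs y)
  map_sigma : ∀ x, abs (σ x) = abs x

namespace InvariantAbs

variable {F : Type u} [Field F] {σ : F ≃+* F} (w : InvariantAbs σ)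

theorem map_zpow (n : ℤ) (x : F) : w.abs ((σ ^ n : RingAut F) x) = w.abs x := by
  induction n with
  | zero => simp
  | succ n ih =>
    rw [add_comm, zpow_add, zpow_one, RingAut.mul_apply, w.map_sigma, ih]
  | pred n ih =>
    rw [← ih, ← w.map_sigma, ← RingAut.mul_apply, ← zpow_one_add]
    congr 3
    ring

theorem nonarch_sub (x y : F) : w.abs (x - y) ≤ max (w.abs x) (w.abs y) := by
  rw [sub_eq_add_neg, ← w.abs.map_neg y]
  exact w.nonarch _ _

end InvariantAbs

/-- Two-sided geometric bound for a sequence satisfying a first order recursion. -/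
theorem geometric_bound {g : ℤ → ℝ} {r C : ℝ} (hr : 0 < r)
    (h₁ : ∀ n, g (n + 1) ≤ max (r * g n) (C * r ^ n))
    (h₂ : ∀ n, r * g n ≤ max (g (n + 1)) (C * r ^ n)) :
    ∀ n, g n ≤ max (g 0) (C / r) * r ^ n := by
  set D := max (g 0) (C / r) with hD
  -- Because the recursion has a maximum instead of a sum, one constant `D` survives every step; the
  -- term `C / r` in `D` is what absorbs `C * r ^ n` into `D * r ^ (n + 1)`.
  have hC : C ≤ D * r := (div_le_iff₀ hr).1 (le_max_right _ _)
  have hCn : ∀ n : ℤ, C * r ^ n ≤ D * r ^ n * r := fun n => by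
    have := mul_le_mul_of_nonneg_right hC (zpow_pos hr n).le
    linarith
  intro n
  induction n with
  | zero => simp [hD]
  | succ n ih =>
    refine (h₁ n).trans (max_le ?_ ?_)
    · rw [zpow_add_one₀ hr.ne']
      have := mul_le_mul_of_nonneg_left ih hr.le
      linarith
    · rw [zpow_add_one₀ hr.ne', ← mul_assoc]
      exact hCn n
  | pred n ih =>
    have h := h₂ (-(n : ℤ) - 1)
    rw [sub_add_cancel] at h
    have h' : r * g (-(n : ℤ) - 1) ≤ D * r ^ (-(n : ℤ) - 1) * r := by
      refine h.trans (max_le ?_ (hCn _))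
      rwa [mul_assoc, ← zpow_add_one₀ hr.ne', sub_add_cancel]
    rw [mul_comm r] at h'
    exact le_of_mul_le_mul_right h' hr

namespace DiffModule

/-! ### Orbits of the automorphism -/

section Orbits

variable {F : Type u} [Field F] {σ : F ≃+* F} {V : Type v} [AddCommGroup V] [Module F V]
  (S : DiffModule F σ V)

/-- `u n = Φⁿ (u 0)` for all integers `n`. -/
def IsOrbit (u : ℤ → V) : Prop := ∀ n, u (n + 1) = S.Φ (u n)

variable {S}

theorem exists_isOrbit (S : DiffModule F σ V) (x : V) : ∃ u, S.IsOrbit u ∧ u 0 = x := by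
  let e : Equiv.Perm V := Equiv.ofBijective S.Φ S.bijective
  refine ⟨fun n => (e ^ n) x, fun n => ?_, by simp⟩
  change (e ^ (n + 1)) x = e ((e ^ n) x)
  rw [add_comm, zpow_add, zpow_one, Equiv.Perm.mul_apply]

theorem IsOrbit.ext {u t : ℤ → V} (hu : S.IsOrbit u) (ht : S.IsOrbit t) (h : u 0 = t 0) (n : ℤ) :
    u n = t n := by
  induction n with
  | zero => exact h
  | succ n ih => rw [hu, ht, ih]
  | pred n ih =>
    apply S.bijective.1
    rw [← hu, ← ht, sub_add_cancel, ih]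

theorem IsOrbit.add {u t : ℤ → V} (hu : S.IsOrbit u) (ht : S.IsOrbit t) :
    S.IsOrbit fun n => u n + t n := fun n => by simp only [hu n, ht n, map_add]

theorem IsOrbit.smul {u : ℤ → V} (hu : S.IsOrbit u) (c : F) :
    S.IsOrbit fun n => (σ ^ n : RingAut F) c • u n := fun n => by
  simp only [hu n, map_smulₛₗ]
  rw [add_comm, zpow_add, zpow_one, RingAut.mul_apply]
  rfl

theorem IsOrbit.shift {u : ℤ → V} (hu : S.IsOrbit u) (k : ℤ) :
    S.IsOrbit fun n => u (n + k) := fun n => by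
  simp only
  rw [add_right_comm, hu]

end Orbits

/-! ### Subspaces of vectors with prescribed two-sided growth -/

section SlopePart

variable {F : Type u} [Field F] {σ : F ≃+* F} {V : Type v} [AddCommGroup V] [Module F V]
  (S : DiffModule F σ V) (w : InvariantAbs σ)

/-- The vectors `x` such that every coordinate of `Φⁿ x` is `O(rⁿ)` for `n` in `ℤ`. -/
def slopePart (r : ℝ) : Submodule F V where
  carrier := {x | ∃ u, S.IsOrbit u ∧ u 0 = x ∧
    ∀ φ : V →ₗ[F] F, ∃ C, ∀ n : ℤ, w.abs (φ (u n)) ≤ C * r ^ n}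
  zero_mem' := ⟨0, fun n => by simp, rfl, fun φ => ⟨0, fun n => by simp⟩⟩
  add_mem' := by
    rintro x y ⟨u, hu, rfl, hu'⟩ ⟨t, ht, rfl, ht'⟩
    refine ⟨_, hu.add ht, rfl, fun φ => ?_⟩
    obtain ⟨C, hC⟩ := hu' φ
    obtain ⟨D, hD⟩ := ht' φ
    refine ⟨C + D, fun n => ?_⟩
    rw [map_add, add_mul]
    exact (w.abs.add_le _ _).trans (add_le_add (hC n) (hD n))
  smul_mem' := by
    rintro c x ⟨u, hu, rfl, hu'⟩
    refine ⟨_, hu.smul c, by simp, fun φ => ?_⟩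
    obtain ⟨C, hC⟩ := hu' φ
    refine ⟨w.abs c * C, fun n => ?_⟩
    rw [map_smul, smul_eq_mul, map_mul, w.map_zpow, mul_assoc]
    exact mul_le_mul_of_nonneg_left (hC n) (w.abs.nonneg c)

variable {S w}

theorem mem_slopePart_of_orbit {r : ℝ} (hr : 0 < r) {u : ℤ → V} (hu : S.IsOrbit u) {k : ℤ}
    (h : u k ∈ S.slopePart w r) (m : ℤ) : u m ∈ S.slopePart w r := by
  obtain ⟨t, ht, h0, h⟩ := h
  have hut : ∀ n, u n = t (n - k) := fun n => by
    have := (hu.shift k).ext ht (by simp [h0]) (n - k)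
    simpa using this
  refine ⟨_, hu.shift m, by simp, fun φ => ?_⟩
  obtain ⟨C, hC⟩ := h φ
  refine ⟨C * r ^ (m - k), fun n => ?_⟩
  rw [hut, mul_assoc, ← zpow_add₀ hr.ne']
  convert hC (n + m - k) using 3
  ring

theorem isStable_slopePart {r : ℝ} (hr : 0 < r) : S.IsStable (S.slopePart w r) := by
  intro x
  obtain ⟨u, hu, rfl⟩ := S.exists_isOrbit x
  rw [← hu]
  exact ⟨fun h => mem_slopePart_of_orbit hr hu h _, fun h => mem_slopePart_of_orbit hr hu h _⟩

/-- Along the orbit, `u (n + 1)` is `σⁿ(c) u n` plus a term of size `O(|c|ⁿ)`, and `|σⁿ(c)| = |c|`;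
the ultrametric recursion then bounds `u` in both directions. -/
theorem mem_slopePart_of_sub_mem {c : F} (hc : c ≠ 0) {x : V}
    (h : S.Φ x - c • x ∈ S.slopePart w (w.abs c)) : x ∈ S.slopePart w (w.abs c) := by
  obtain ⟨u, hu, rfl⟩ := S.exists_isOrbit x
  obtain ⟨t, ht, h0, ht'⟩ := h
  have hr := w.abs.pos hc
  -- Both sides are orbits, so it suffices to compare them at `n = 0`.
  have key : ∀ n, u (n + 1) = (σ ^ n : RingAut F) c • u n + t n :=
    (hu.shift 1).ext ((hu.smul c).add ht) (by simp [h0, ← hu 0])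
  refine ⟨u, hu, rfl, fun φ => ?_⟩
  obtain ⟨C, hC⟩ := ht' φ
  refine ⟨_, geometric_bound (C := C) hr (fun n => ?_) fun n => ?_⟩
  · rw [key, map_add, map_smul, smul_eq_mul]
    refine (w.nonarch _ _).trans (max_le_max ?_ (hC n))
    rw [map_mul, w.map_zpow]
  · have : (σ ^ n : RingAut F) c * φ (u n) = φ (u (n + 1)) - φ (t n) := by
      rw [key, map_add, map_smul, smul_eq_mul, add_sub_cancel_right]
    rw [← w.map_zpow n c, ← map_mul, this, w.map_zpow]
    exact (w.nonarch_sub _ _).trans (max_le_max le_rfl (hC n))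

/-- Growth is tested on all linear forms, and every linear form on `N` extends to `V`. -/
theorem restrict_slopePart {N : Submodule F V} (hN : S.IsStable N) (r : ℝ) :
    (S.restrict N hN).slopePart w r = (S.slopePart w r).comap N.subtype := by
  ext x
  constructor
  · rintro ⟨u, hu, rfl, h⟩
    refine ⟨fun n => u n, fun n => congrArg Subtype.val (hu n), rfl, fun φ => ?_⟩
    exact h (φ ∘ₗ N.subtype)
  · rintro ⟨t, ht, h0, h⟩
    obtain ⟨u, hu, rfl⟩ := (S.restrict N hN).exists_isOrbit x
    have hut : ∀ n, t n = u n := ht.ext (fun n => congrArg Subtype.val (hu n)) h0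
    refine ⟨u, hu, rfl, fun φ => ?_⟩
    obtain ⟨ψ, hψ⟩ := LinearMap.exists_extend φ
    obtain ⟨C, hC⟩ := h ψ
    refine ⟨C, fun n => ?_⟩
    rw [← hψ]
    simpa [hut] using hC n

end SlopePart

/-! ### Slope parts of a triangular module: dimension bound and spanning -/

section Triangular

variable {F : Type u} [Field F] {σ : F ≃+* F} {V : Type v} [AddCommGroup V] [Module F V]
  {S : DiffModule F σ V} {w : InvariantAbs σ} {n : ℕ} {b : Module.Basis (Fin n) F V} {a : Fin n → F}

theorem repr_eq_zero_of_mem_span {j : Fin n} {x : V} (hx : x ∈ Submodule.span F (b '' Set.Iio j))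
    {i : Fin n} (hi : j ≤ i) : b.repr x i = 0 := by
  have := (b.mem_span_image).1 hx
  by_contra h
  exact absurd (this (Finsupp.mem_support_iff.2 h)) (not_lt.2 hi)

/-- The leading coordinate of `Φ x`. -/
theorem IsTriangular.repr_apply (h : S.IsTriangular b a) {j : Fin n} {x : V}
    (hx : ∀ i, j < i → b.repr x i = 0) : b.repr (S.Φ x) j = a j * σ (b.repr x j) := by
  conv_lhs => rw [← b.sum_repr x]
  rw [map_sum, map_sum, Finsupp.finsetSum_apply, Finset.sum_eq_single j]
  · rw [map_smulₛₗ, map_smul, Finsupp.smul_apply, smul_eq_mul, mul_comm]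
    congr 1
    have := repr_eq_zero_of_mem_span (h j).2 le_rfl
    simpa [sub_eq_zero] using this
  · intro i _ hij
    rw [map_smulₛₗ, map_smul, Finsupp.smul_apply, smul_eq_mul]
    rcases lt_or_gt_of_ne hij with hij | hij
    · have := repr_eq_zero_of_mem_span (h i).2 hij.le
      simp only [map_sub, map_smul, Finsupp.sub_apply, Finsupp.smul_apply, b.repr_self,
        Finsupp.single_eq_of_ne hij.ne', smul_zero, sub_zero] at this
      rw [this, mul_zero]
    · simp [hx i hij]
  · simp

/-- Letting `n → +∞` gives `s ≤ r`, and `n → -∞` gives `r ≤ s`; this is why growth is imposed in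
both directions. -/
theorem eq_of_geometric_growth {r s A C : ℝ} (hr : 0 < r) (hs : 0 < s) (hA : 0 < A)
    (h : ∀ n : ℤ, A * s ^ n ≤ C * r ^ n) : s = r := by
  have key : ∀ x : ℝ, 0 < x → (∀ n : ℕ, A * x ^ n ≤ C) → x ≤ 1 := by
    intro x hx h
    by_contra! h1
    obtain ⟨n, hn⟩ := pow_unbounded_of_one_lt (C / A) h1
    rw [div_lt_iff₀ hA] at hn
    linarith [h n]
  have h' : ∀ n : ℤ, A * (s / r) ^ n ≤ C := fun n => by
    rw [div_zpow, ← mul_div_assoc, div_le_iff₀ (zpow_pos hr n)]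
    exact h n
  have h1 := key (s / r) (by positivity) fun n => by simpa using h' n
  have h2 := key (r / s) (by positivity) fun n => by
    have := h' (-n)
    rw [zpow_neg, ← inv_zpow, inv_div, zpow_natCast] at this
    exact this
  rw [div_le_one hr] at h1
  rw [div_le_one hs] at h2
  exact le_antisymm h1 h2

/-- Let `j` be the last index at which the orbit has a nonzero coordinate. That coordinate has size
exactly proportional to `|a j|ᵏ`, so the growth condition forces `|a j| = r`, a case in which it was
assumed to vanish. -/
theorem IsTriangular.eq_zero_of_mem_slopePart (h : S.IsTriangular b a) {r : ℝ} (hr : 0 < r)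
    {x : V} (hx : x ∈ S.slopePart w r) (hx0 : ∀ j, w.abs (a j) = r → b.repr x j = 0) : x = 0 := by
  classical
  obtain ⟨u, hu, rfl, hgr⟩ := hx
  by_contra hne
  -- The whole orbit is used, not only `u 0`, so that the coordinates beyond the maximum of `J`
  -- vanish at all times.
  let J : Finset (Fin n) := Finset.univ.filter fun j => ∃ m : ℤ, b.repr (u m) j ≠ 0
  have hJ : J.Nonempty := by
    by_contra hJ
    rw [Finset.not_nonempty_iff_eq_empty] at hJ
    apply hne
    apply b.repr.injective
    ext j
    by_contra hj
    have : j ∈ J := Finset.mem_filter.2 ⟨Finset.mem_univ _, 0, by simpa using hj⟩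
    simp [hJ] at this
  obtain ⟨j, hjJ, hmax⟩ := J.exists_max_image id hJ
  obtain ⟨-, m, hm⟩ := Finset.mem_filter.1 hjJ
  have hzero : ∀ k i, j < i → b.repr (u k) i = 0 := fun k i hi => by
    by_contra hc
    exact absurd (hmax i (Finset.mem_filter.2 ⟨Finset.mem_univ _, k, hc⟩)) (not_le.2 hi)
  have ha := w.abs.pos (h j).1
  have hrec : ∀ k, w.abs (b.repr (u (k + 1)) j) = w.abs (a j) * w.abs (b.repr (u k) j) := fun k => by
    rw [hu, h.repr_apply (hzero k), map_mul, w.map_sigma]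
  have hval : ∀ k : ℤ, w.abs (b.repr (u k) j) = w.abs (b.repr (u 0) j) * w.abs (a j) ^ k := by
    intro k
    induction k with
    | zero => simp
    | succ k ih => rw [hrec, ih, zpow_add_one₀ ha.ne']; ring
    | pred k ih =>
      have := hrec (-(k : ℤ) - 1)
      rw [sub_add_cancel, ih] at this
      rw [zpow_sub_one₀ ha.ne', ← mul_assoc, this]
      field_simp
  have h0 : b.repr (u 0) j ≠ 0 := fun h0 => hm (by simpa [h0] using hval m)
  obtain ⟨C, hC⟩ := hgr (b.coord j)
  exact h0 (hx0 j (eq_of_geometric_growth hr ha (w.abs.pos h0) fun k => by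
    rw [← hval]; exact hC k))

theorem IsTriangular.finrank_slopePart_le (h : S.IsTriangular b a) {r : ℝ} (hr : 0 < r) :
    Module.finrank F (S.slopePart w r) ≤ Nat.card {j // w.abs (a j) = r} := by
  classical
  let f : S.slopePart w r →ₗ[F] ({j // w.abs (a j) = r} → F) :=
    (LinearMap.pi fun j => b.coord j.1) ∘ₗ (S.slopePart w r).subtype
  have hf : Function.Injective f := by
    rw [injective_iff_map_eq_zero]
    intro x hx
    exact Subtype.ext (h.eq_zero_of_mem_slopePart hr x.2 fun j hj => congrFun hx ⟨j, hj⟩)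
  have := LinearMap.finrank_le_finrank_of_injective hf
  rwa [Module.finrank_fintype_fun_eq_card, ← Nat.card_eq_fintype_card] at this

/-- `f = a σ(h) - c h` is solvable whenever `|a| ≠ |c|`. -/
def SolvesRankOne {σ : F ≃+* F} (w : InvariantAbs σ) : Prop :=
  ∀ a c : F, a ≠ 0 → c ≠ 0 → w.abs a ≠ w.abs c → ∀ f, ∃ h, a * σ h - c * h = f

/-- On the span of the first `m` basis vectors, `Φ - c` is surjective modulo the part of growth
`|c|`. The constant `c` is quantified inside the induction because the case `|a j| = |c|` also uses
the hypothesis at `a j`. -/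
theorem IsTriangular.exists_sub_mem_slopePart (h : S.IsTriangular b a) (hw : SolvesRankOne w)
    (m : ℕ) : ∀ c : F, c ≠ 0 → ∀ y ∈ Submodule.span F (b '' {i | i.1 < m}),
      ∃ x ∈ Submodule.span F (b '' {i | i.1 < m}),
        y - (S.Φ x - c • x) ∈ S.slopePart w (w.abs c) := by
  induction m with
  | zero =>
    intro c _ y hy
    refine ⟨0, zero_mem _, ?_⟩
    simp at hy
    simp [hy]
  | succ m ih =>
    intro c hc y hy
    by_cases hm : m < n
    swap
    · have : {i : Fin n | i.1 < m + 1} = {i : Fin n | i.1 < m} := by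
        ext i; simp only [Set.mem_ofPred_eq]; omega
      rw [this] at hy ⊢
      exact ih c hc y hy
    let j : Fin n := ⟨m, hm⟩
    have hset : {i : Fin n | i.1 < m + 1} = insert j {i : Fin n | i.1 < m} := by
      ext i
      simp only [Set.mem_ofPred_eq, Set.mem_insert_iff, j, Fin.ext_iff]
      omega
    have hIio : Set.Iio j = {i : Fin n | i.1 < m} := rfl
    have hle : Submodule.span F (b '' {i : Fin n | i.1 < m}) ≤
        Submodule.span F (b '' {i : Fin n | i.1 < m + 1}) := by
      rw [hset]
      exact Submodule.span_mono (Set.image_mono (Set.subset_insert _ _))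
    have hbj : b j ∈ Submodule.span F (b '' {i : Fin n | i.1 < m + 1}) :=
      Submodule.subset_span ⟨j, by simp [j], rfl⟩
    have hyj := (h j).2
    rw [hIio] at hyj
    rw [hset, Set.image_insert_eq, Submodule.mem_span_insert] at hy
    obtain ⟨f, y', hy', rfl⟩ := hy
    by_cases hac : w.abs (a j) = w.abs c
    -- Here `b j - x` lies in the slope part, so `f • b j` may be replaced by `f • x`, which
    -- involves earlier vectors only.
    · obtain ⟨x, hx, hxm⟩ := ih (a j) (h j).1 _ hyj
      have hb' : b j - x ∈ S.slopePart w (w.abs (a j)) := by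
        apply mem_slopePart_of_sub_mem (h j).1
        convert hxm using 1
        rw [map_sub, smul_sub]
        abel
      rw [hac] at hb'
      obtain ⟨x', hx', hxm'⟩ := ih c hc (y' + f • x) (add_mem hy' (Submodule.smul_mem _ _ hx))
      refine ⟨x', hle hx', ?_⟩
      convert add_mem (Submodule.smul_mem _ f hb') hxm' using 1
      rw [smul_sub]
      abel
    -- The vector `g • b j` accounts for `f • b j` under `Φ - c`, up to an error `σ g • (Φ (b j) - a
    -- j • b j)` in the earlier span.
    · obtain ⟨g, rfl⟩ := hw (a j) c (h j).1 hc hac f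
      obtain ⟨x', hx', hxm'⟩ := ih c hc (y' - σ g • (S.Φ (b j) - a j • b j))
        (sub_mem hy' (Submodule.smul_mem _ _ hyj))
      refine ⟨x' + g • b j, add_mem (hle hx') (Submodule.smul_mem _ _ hbj), ?_⟩
      convert hxm' using 1
      rw [map_add, map_smulₛₗ]
      simp only [RingHom.coe_coe]
      module

theorem IsTriangular.mem_iSup_slopePart (h : S.IsTriangular b a) (hw : SolvesRankOne w)
    (x : V) : x ∈ ⨆ j, S.slopePart w (w.abs (a j)) := by
  have key : ∀ m : ℕ, Submodule.span F (b '' {i | i.1 < m}) ≤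
      ⨆ j, S.slopePart w (w.abs (a j)) := by
    intro m
    induction m with
    | zero => simp
    | succ m ih =>
      rw [Submodule.span_le]
      rintro _ ⟨j, hj, rfl⟩
      rcases Nat.lt_succ_iff_lt_or_eq.1 hj with hj | hj
      · exact ih (Submodule.subset_span ⟨j, hj, rfl⟩)
      · have hIio : Set.Iio j = {i : Fin n | i.1 < m} := by
          rw [← hj]; rfl
        have hyj := (h j).2
        rw [hIio] at hyj
        obtain ⟨x, hx, hxm⟩ := h.exists_sub_mem_slopePart hw m (a j) (h j).1 _ hyj
        have hb' : b j - x ∈ S.slopePart w (w.abs (a j)) := by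
          apply mem_slopePart_of_sub_mem (h j).1
          convert hxm using 1
          rw [map_sub, smul_sub]
          abel
        rw [← sub_add_cancel (b j) x]
        exact add_mem (Submodule.mem_iSup_of_mem j hb') (ih hx)
  refine key n ?_
  have : {i : Fin n | i.1 < n} = Set.univ := by ext i; simp
  rw [this, Set.image_univ, b.span_eq]
  trivial

end Triangular

end DiffModule

/-! ### Linear `q`-difference equations in power series -/

theorem exists_strongRec {α : Type*} (F : (n : ℕ) → ((m : ℕ) → m < n → α) → α) :
    ∃ y : ℕ → α, ∀ n, y n = F n fun m _ => y m :=
  ⟨fun n => Nat.strongRec F n, fun n => Nat.strongRec_eq F n⟩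

/-- The coefficient of `zⁿ` is a linear equation for `y n` in terms of earlier coefficients, whose
leading factor is the indicial polynomial at `qⁿ`. At `n = 0` that factor may vanish, so `y₀` is
prescribed and only required to be compatible. -/
theorem exists_powerSeries_solution (q : ℂ) (k : ℕ) (d : ℕ → PowerSeries ℂ) (g : PowerSeries ℂ)
    (y₀ : ℂ) (h₀ : (∑ j ∈ Finset.range k, PowerSeries.coeff 0 (d j)) * y₀ = PowerSeries.coeff 0 g)
    (h : ∀ n, 1 ≤ n → ∑ j ∈ Finset.range k, PowerSeries.coeff 0 (d j) * (q ^ n) ^ j ≠ 0) :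
    ∃ y : PowerSeries ℂ, PowerSeries.coeff 0 y = y₀ ∧
      ∑ j ∈ Finset.range k, d j * PowerSeries.rescale (q ^ j) y = g := by
  let Q : ℕ → ℕ → ℂ := fun i n =>
    ∑ j ∈ Finset.range k, PowerSeries.coeff i (d j) * (q ^ n) ^ j
  obtain ⟨y, hy⟩ := exists_strongRec (α := ℂ) fun n y => if n = 0 then y₀ else
    (PowerSeries.coeff n g - ∑ m : Fin n, Q (n - m) m * y m m.2) / Q 0 n
  refine ⟨PowerSeries.mk y, by rw [PowerSeries.coeff_mk, hy]; simp, ?_⟩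
  ext n
  have hn : PowerSeries.coeff n (∑ j ∈ Finset.range k,
      d j * PowerSeries.rescale (q ^ j) (PowerSeries.mk y)) =
      ∑ m ∈ Finset.range (n + 1), Q (n - m) m * y m := by
    simp only [map_sum, PowerSeries.coeff_mul, PowerSeries.coeff_rescale, PowerSeries.coeff_mk,
      Q, Finset.sum_mul]
    rw [Finset.sum_comm, ← Finset.Nat.sum_antidiagonal_swap,
      Finset.Nat.sum_antidiagonal_eq_sum_range_succ_mk]
    refine Finset.sum_congr rfl fun m _ => Finset.sum_congr rfl fun j _ => ?_
    simp only [Prod.swap_prod_mk]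
    rw [← pow_mul, ← pow_mul, mul_comm j m]
    ring
  rw [hn, Finset.sum_range_succ, Nat.sub_self]
  rcases Nat.eq_zero_or_pos n with rfl | hpos
  · rw [hy 0, ← h₀]
    simp [Q]
  · rw [hy n, if_neg hpos.ne', mul_div_cancel₀ _ (h n hpos), Finset.sum_range]
    ring

/-! ### Laurent series -/

theorem coeff_sigma (q : ℂˣ) (f : K) (n : ℤ) :
    (sigma q f).coeff n = ((q ^ n : ℂˣ) : ℂ) * f.coeff n := rfl

theorem sigma_single (q : ℂˣ) (t : ℤ) (r : ℂ) :
    sigma q (HahnSeries.single t r : K) = HahnSeries.single t (((q ^ t : ℂˣ) : ℂ) * r) := by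
  ext n
  rw [coeff_sigma]
  by_cases h : n = t
  · subst h; simp
  · simp [HahnSeries.coeff_single_of_ne h]

theorem sigma_C (q : ℂˣ) (r : ℂ) : sigma q (HahnSeries.C r : K) = HahnSeries.C r := by
  rw [HahnSeries.C_apply, sigma_single]; simp

theorem sigma_coe (q : ℂˣ) (y : PowerSeries ℂ) :
    sigma q (y : K) = (PowerSeries.rescale (q : ℂ) y : PowerSeries ℂ) := by
  ext n
  rw [coeff_sigma, PowerSeries.coeff_coe, PowerSeries.coeff_coe]
  split_ifs with h
  · simp
  · obtain ⟨m, rfl⟩ := Int.eq_ofNat_of_zero_le (not_lt.1 h)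
    simp [PowerSeries.coeff_rescale]

theorem sigma_iterate_coe (q : ℂˣ) (j : ℕ) (y : PowerSeries ℂ) :
    (sigma q)^[j] (y : K) = (PowerSeries.rescale ((q : ℂ) ^ j) y : PowerSeries ℂ) := by
  induction j with
  | zero => simp
  | succ j ih =>
    rw [Function.iterate_succ_apply', ih, sigma_coe, PowerSeries.rescale_rescale, pow_succ]

theorem order_eq_of_coeff {f g : K} (h : ∀ n, f.coeff n = 0 ↔ g.coeff n = 0) :
    f.order = g.order := by
  have hz : f = 0 ↔ g = 0 := by
    constructor
    · rintro rfl; ext n; simpa using (h n)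
    · rintro rfl; ext n; simpa using (h n)
  by_cases hf : f = 0
  · rw [hf, hz.1 hf]
  · have hg := mt hz.2 hf
    exact le_antisymm
      (HahnSeries.order_le_of_coeff_ne_zero (mt (h _).1 (HahnSeries.coeff_order_eq_zero.not.2 hg)))
      (HahnSeries.order_le_of_coeff_ne_zero (mt (h _).2 (HahnSeries.coeff_order_eq_zero.not.2 hf)))

theorem order_sigma (q : ℂˣ) (f : K) : (sigma q f).order = f.order :=
  order_eq_of_coeff fun n => by rw [coeff_sigma]; simp [zpow_ne_zero]

theorem exists_powerSeries_of_le_order {f : K} {N : ℤ} (h : f = 0 ∨ N ≤ f.order) :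
    ∃ p : PowerSeries ℂ, f = HahnSeries.single N 1 * (p : K) ∧
      PowerSeries.coeff 0 p = f.coeff N := by
  refine ⟨PowerSeries.mk fun n => f.coeff (N + n), ?_, by simp⟩
  ext n
  have := HahnSeries.coeff_single_mul_add (r := (1 : ℂ))
    (x := ((PowerSeries.mk fun n => f.coeff (N + n) : PowerSeries ℂ) : K)) (a := n - N) (b := N)
  rw [sub_add_cancel] at this
  rw [this, one_mul, PowerSeries.coeff_coe]
  split_ifs with hn
  · rcases h with rfl | h
    · simp
    · exact HahnSeries.coeff_eq_zero_of_lt_order (by omega)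
  · rw [PowerSeries.coeff_mk, Int.natCast_natAbs, abs_of_nonneg (not_lt.1 hn)]
    congr 1
    ring

/-- After division by `z ^ N`, with `N` the smaller of the two orders, exactly one of `a`, `c` has a
nonzero constant term, so the indicial expression has a single nonzero term and never vanishes. -/
theorem exists_sigma_sub_eq (q : ℂˣ) {a c : K} (ha : a ≠ 0) (hc : c ≠ 0)
    (hac : a.order ≠ c.order) (f : K) : ∃ h, a * sigma q h - c * h = f := by
  have hN : ∃ N, N = min a.order c.order := ⟨_, rfl⟩
  obtain ⟨N, hN⟩ := hN
  obtain ⟨a', ha', ha0⟩ := exists_powerSeries_of_le_order (f := a) (N := N)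
    (Or.inr (hN ▸ min_le_left _ _))
  obtain ⟨c', hc', hc0⟩ := exists_powerSeries_of_le_order (f := c) (N := N)
    (Or.inr (hN ▸ min_le_right _ _))
  obtain ⟨f', hf', -⟩ := exists_powerSeries_of_le_order (f := f) (N := f.order) (Or.inr le_rfl)
  -- The substitution `h = z ^ t * y` turns the equation into `q ^ t * a' * y(q z) - c' * y = f'`
  -- for power series.
  let t := f.order - N
  let d : ℕ → PowerSeries ℂ := fun j =>
    if j = 0 then -c' else PowerSeries.C ((q ^ t : ℂˣ) : ℂ) * a'
  have hd : ∀ n : ℕ, ∑ j ∈ Finset.range 2, PowerSeries.coeff 0 (d j) * ((q : ℂ) ^ n) ^ j ≠ 0 := by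
    intro n
    rw [Finset.sum_range_succ, Finset.sum_range_one]
    simp only [d, one_ne_zero, if_true, if_false, map_neg, PowerSeries.coeff_C_mul, pow_zero,
      pow_one, mul_one, hc0, ha0]
    rcases lt_or_gt_of_ne hac with hlt | hlt
    · rw [min_eq_left hlt.le] at hN
      rw [hN, HahnSeries.coeff_eq_zero_of_lt_order hlt]
      simpa [HahnSeries.coeff_order_eq_zero, zpow_ne_zero] using ha
    · rw [min_eq_right hlt.le] at hN
      rw [hN, HahnSeries.coeff_eq_zero_of_lt_order hlt]
      simpa [HahnSeries.coeff_order_eq_zero] using hc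
  obtain ⟨y, -, hy⟩ := exists_powerSeries_solution q 2 d f'
    (PowerSeries.coeff 0 f' / ∑ j ∈ Finset.range 2, PowerSeries.coeff 0 (d j)) (by
      rw [mul_div_cancel₀]
      simpa using hd 0) (fun n _ => hd n)
  rw [Finset.sum_range_succ, Finset.sum_range_one] at hy
  simp only [d, one_ne_zero, if_true, if_false, pow_zero, pow_one] at hy
  rw [PowerSeries.rescale_one, RingHom.id_apply] at hy
  refine ⟨HahnSeries.single t 1 * (y : K), ?_⟩
  rw [hf', ← hy, PowerSeries.coe_add, PowerSeries.coe_mul, PowerSeries.coe_mul, PowerSeries.coe_mul,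
    PowerSeries.coe_neg, map_mul, sigma_coe, sigma_single, PowerSeries.coe_C]
  have h1 : (HahnSeries.single f.order 1 : K) = HahnSeries.single N 1 * HahnSeries.single t 1 := by
    rw [HahnSeries.single_mul_single, one_mul, add_sub_cancel]
  have h2 : (HahnSeries.single t (((q ^ t : ℂˣ) : ℂ) * 1) : K) =
      HahnSeries.C ((q ^ t : ℂˣ) : ℂ) * HahnSeries.single t 1 := by
    rw [HahnSeries.C_apply, HahnSeries.single_mul_single, zero_add]
  rw [h1, h2]
  conv_lhs => rw [ha', hc']
  ring

open Classical in
theorem abs_laurent_nonarch {s : ℝ} (hs : 0 < s) (f g : K) :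
    (if f + g = 0 then 0 else Real.exp (-(s * (f + g).order))) ≤
      max (if f = 0 then 0 else Real.exp (-(s * f.order)))
        (if g = 0 then 0 else Real.exp (-(s * g.order))) := by
  by_cases hf : f = 0
  · simp [hf]
  by_cases hg : g = 0
  · simp [hg]
  by_cases hfg : f + g = 0
  · rw [if_pos hfg, if_neg hf]
    exact le_max_of_le_left (Real.exp_pos _).le
  rw [if_neg hf, if_neg hg, if_neg hfg]
  rcases min_le_iff.1 (HahnSeries.min_order_le_order_add hfg) with h | h
  · refine le_max_of_le_left (Real.exp_le_exp.2 (neg_le_neg (mul_le_mul_of_nonneg_left ?_ hs.le)))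
    exact_mod_cast h
  · refine le_max_of_le_right (Real.exp_le_exp.2 (neg_le_neg (mul_le_mul_of_nonneg_left ?_ hs.le)))
    exact_mod_cast h

open Classical in
/-- The absolute value `exp (- s ord f)` on `ℂ((z))`. -/
def laurentAbs (q : ℂˣ) (s : ℝ) (hs : 0 < s) : InvariantAbs (sigma q) where
  abs :=
    { toFun f := if f = 0 then 0 else Real.exp (-(s * f.order))
      map_mul' f g := by
        by_cases hf : f = 0
        · simp [hf]
        by_cases hg : g = 0
        · simp [hg]
        rw [if_neg hf, if_neg hg, if_neg (mul_ne_zero hf hg), HahnSeries.order_mul hf hg,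
          ← Real.exp_add]
        push_cast
        ring_nf
      nonneg' f := by split_ifs <;> positivity
      eq_zero' f := by
        by_cases hf : f = 0
        · simp [hf]
        · simp [hf, Real.exp_ne_zero]
      add_le' f g := (abs_laurent_nonarch hs f g).trans
        (max_le_add_of_nonneg (by split_ifs <;> positivity) (by split_ifs <;> positivity)) }
  nonarch f g := abs_laurent_nonarch hs f g
  map_sigma f := by
    change (if sigma q f = 0 then 0 else Real.exp (-(s * (sigma q f).order))) =
      if f = 0 then 0 else Real.exp (-(s * f.order))
    simp [order_sigma]

theorem laurentAbs_apply {q : ℂˣ} {s : ℝ} {hs : 0 < s} {f : K} (hf : f ≠ 0) :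
    (laurentAbs q s hs).abs f = Real.exp (-(s * f.order)) := if_neg hf

theorem solvesRankOne_laurentAbs (q : ℂˣ) (s : ℝ) (hs : 0 < s) :
    DiffModule.SolvesRankOne (laurentAbs q s hs) := fun a c ha hc hac f =>
  exists_sigma_sub_eq q ha hc (fun h => hac (by
    rw [laurentAbs_apply ha, laurentAbs_apply hc, h])) f

/-! ### Eigenvectors of cyclic modules -/

theorem exists_root_max_norm (p : Polynomial ℂ) (h : 0 < p.degree) :
    ∃ β, p.IsRoot β ∧ ∀ γ, ‖β‖ < ‖γ‖ → ¬ p.IsRoot γ := by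
  have hp : p ≠ 0 := by rintro rfl; simp at h
  obtain ⟨z, hz⟩ := Complex.exists_root h
  obtain ⟨β, hβ, hmax⟩ := p.roots.toFinset.exists_max_image (‖·‖)
    ⟨z, by simpa [hp] using hz⟩
  refine ⟨β, by simpa [hp] using hβ, fun γ hγ hr => ?_⟩
  exact absurd (hmax γ (by simpa [hp] using hr)) (not_le.2 hγ)

/-- The indicial polynomial at `qⁿ` is `Q (β qⁿ)`, with `Q = -1 + ∑ e_i(0) X ^ (i + 1)`. For `β` a
root of largest modulus, `Q` vanishes at `n = 0`, which allows `y(0) = 1`, and at no `n ≥ 1`, since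
`|β qⁿ| > |β|`. -/
theorem exists_sum_sigma_iterate_eq (q : ℂˣ) (hq : 1 < ‖(q : ℂ)‖) (k : ℕ) (e : ℕ → K)
    (he : ∀ i < k, e i = 0 ∨ 0 ≤ (e i).order) (he' : ∃ i < k, (e i).coeff 0 ≠ 0) :
    ∃ β : ℂ, β ≠ 0 ∧ ∃ y : K, y ≠ 0 ∧
      ∑ i ∈ Finset.range k, HahnSeries.C (β ^ (i + 1)) * e i * (sigma q)^[i + 1] y = y := by
  have : ∀ i, ∃ p : PowerSeries ℂ, i < k → e i = p := by
    intro i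
    by_cases hi : i < k
    · obtain ⟨p, hp, -⟩ := exists_powerSeries_of_le_order (N := 0) (he i hi)
      exact ⟨p, fun _ => by rw [hp]; exact one_mul _⟩
    · exact ⟨0, fun h => absurd h hi⟩
  choose p hp using this
  have hp0 : ∀ i < k, PowerSeries.coeff 0 (p i) = (e i).coeff 0 := fun i hi => by
    rw [hp i hi, PowerSeries.coeff_coe]; simp
  let Q : Polynomial ℂ := -1 + ∑ i ∈ Finset.range k,
    Polynomial.C (PowerSeries.coeff 0 (p i)) * Polynomial.X ^ (i + 1)
  have hQ : ∀ x, Q.eval x = -1 + ∑ i ∈ Finset.range k, PowerSeries.coeff 0 (p i) * x ^ (i + 1) := by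
    intro x
    simp [Q, Polynomial.eval_finsetSum]
  have hdeg : 0 < Q.degree := by
    obtain ⟨i, hi, hne⟩ := he'
    have hco : Q.coeff (i + 1) ≠ 0 := by
      have : Q.coeff (i + 1) = PowerSeries.coeff 0 (p i) := by
        simp only [Q, Polynomial.coeff_add, Polynomial.coeff_neg, Polynomial.finsetSum_coeff,
          Polynomial.coeff_C_mul_X_pow, Polynomial.coeff_one]
        simp [hi]
      rw [this, hp0 i hi]
      exact hne
    have := Polynomial.le_degree_of_ne_zero hco
    exact lt_of_lt_of_le (by exact_mod_cast Nat.succ_pos i) this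
  obtain ⟨β, hβ, hmax⟩ := exists_root_max_norm Q hdeg
  have hβ0 : β ≠ 0 := by
    rintro rfl
    have := hQ 0
    rw [hβ.eq_zero] at this
    simp at this
  let d : ℕ → PowerSeries ℂ := fun j => Nat.casesOn j (-1) fun i => PowerSeries.C (β ^ (i + 1)) * p i
  have hd : ∀ x, ∑ j ∈ Finset.range (k + 1), PowerSeries.coeff 0 (d j) * x ^ j = Q.eval (β * x) := by
    intro x
    rw [hQ, Finset.sum_range_succ', add_comm]
    congr 1
    · simp [d]
    · refine Finset.sum_congr rfl fun i _ => ?_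
      simp only [d, PowerSeries.coeff_C_mul]
      ring
  obtain ⟨y, hy0, hy⟩ := exists_powerSeries_solution q (k + 1) d 0 1 (by
      have := hd 1
      simp only [one_pow, mul_one] at this
      rw [this, hβ.eq_zero]; simp) (fun n hn => by
      rw [hd]
      refine hmax _ ?_
      rw [norm_mul, norm_pow]
      have h1 := one_lt_pow₀ hq (Nat.one_le_iff_ne_zero.1 hn)
      have h2 := norm_pos_iff.2 hβ0
      nlinarith)
  refine ⟨β, hβ0, y, ?_, ?_⟩
  · intro h
    have : (y : K).coeff 0 = 0 := by rw [h]; simp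
    rw [PowerSeries.coeff_coe] at this
    simp_all
  · have := congrArg (HahnSeries.ofPowerSeries ℤ ℂ) hy
    rw [Finset.sum_range_succ' _ k, map_add, map_sum, map_zero] at this
    have hd0 : d 0 = -1 := rfl
    rw [hd0, pow_zero, PowerSeries.rescale_one, RingHom.id_apply, neg_one_mul, map_neg,
      add_neg_eq_zero] at this
    refine Eq.trans (Finset.sum_congr rfl fun i hi => ?_) this
    rw [map_mul, map_mul, sigma_iterate_coe, hp i (Finset.mem_range.1 hi)]
    congr 2
    exact (PowerSeries.coe_C _).symm

/-- These are the equations for `∑ x i v_i` to be an eigenvector when `Φ v_i = v_{i+1}` and `Φ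
v_{k-1} = ∑ c_i v_i`. With `a = β⁻¹ z ^ d` and `B = a⁻¹ σ` they are solved recursively from `y = x
(k - 1)`, leaving the closing condition `∑ B^i (c_{k-1-i} B y) = y`. The conditions on `d` (an
integral slope of the Newton polygon) make its coefficients integral, one of them with nonzero
constant term. -/
theorem exists_eigenvector_coordinates (q : ℂˣ) (hq : 1 < ‖(q : ℂ)‖) (k : ℕ) (c : ℕ → K) (d : ℤ)
    (hd : ∀ i < k, c (k - 1 - i) ≠ 0 → (i + 1) * d ≤ (c (k - 1 - i)).order)
    (hex : ∃ i < k, c (k - 1 - i) ≠ 0 ∧ (c (k - 1 - i)).order = (i + 1) * d) :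
    ∃ a : K, a ≠ 0 ∧ ∃ x : ℕ → K, x (k - 1) ≠ 0 ∧ a * x 0 = c 0 * sigma q (x (k - 1)) ∧
      ∀ i, a * x (i + 1) = sigma q (x i) + c (i + 1) * sigma q (x (k - 1)) := by
  let s : K := HahnSeries.single (-d) 1
  have hs0 : s ≠ 0 := HahnSeries.single_ne_zero one_ne_zero
  have hs : (HahnSeries.single d 1 : K) * s = 1 := by
    rw [HahnSeries.single_mul_single, add_neg_cancel, one_mul]; rfl
  let B₀ : K → K := fun x => s * sigma q x
  have hB₀order : ∀ (i : ℕ) (x : K), x ≠ 0 →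
      B₀^[i] x ≠ 0 ∧ (B₀^[i] x).order = x.order - i * d := by
    intro i x hx
    induction i with
    | zero => simpa using hx
    | succ i ih =>
      rw [Function.iterate_succ_apply']
      have h0 : sigma q (B₀^[i] x) ≠ 0 := by simpa using ih.1
      refine ⟨mul_ne_zero hs0 h0, ?_⟩
      rw [HahnSeries.order_mul hs0 h0, order_sigma, ih.2, HahnSeries.order_single one_ne_zero]
      push_cast
      ring
  have hB₀mul : ∀ (i : ℕ) (x y : K), B₀^[i] (x * y) = B₀^[i] x * (sigma q)^[i] y := by
    intro i x y
    induction i with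
    | zero => rfl
    | succ i ih =>
      simp only [Function.iterate_succ_apply', ih, B₀, map_mul, mul_assoc]
  have hB₀zero : ∀ i, B₀^[i] 0 = 0 := fun i => Function.iterate_fixed (by simp [B₀]) i
  -- Moving `y` out of `B₀^i` leaves this coefficient of `σ^(i+1) y`; its order is `ord c_{k-1-i} -
  -- (i + 1) d`.
  let e : ℕ → K := fun i => B₀^[i] (c (k - 1 - i) * s)
  have heorder : ∀ i, c (k - 1 - i) ≠ 0 →
      e i ≠ 0 ∧ (e i).order = (c (k - 1 - i)).order - (i + 1) * d := by
    intro i hi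
    obtain ⟨h1, h2⟩ := hB₀order i (c (k - 1 - i) * s) (mul_ne_zero hi hs0)
    refine ⟨h1, h2.trans ?_⟩
    rw [HahnSeries.order_mul hi hs0, HahnSeries.order_single one_ne_zero]
    ring
  obtain ⟨β, hβ, y, hy, hsum⟩ := exists_sum_sigma_iterate_eq q hq k e (fun i hi => by
      by_cases h0 : c (k - 1 - i) = 0
      · left; simp only [e, h0, zero_mul, hB₀zero]
      · right; rw [(heorder i h0).2]; linarith [hd i hi h0]) (by
      obtain ⟨i, hi, h0, hi'⟩ := hex
      refine ⟨i, hi, ?_⟩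
      have h := heorder i h0
      rw [hi', sub_self] at h
      rw [← h.2]
      exact HahnSeries.coeff_order_eq_zero.not.2 h.1)
  let B : K →+ K :=
    { toFun x := HahnSeries.C β * B₀ x
      map_zero' := by simp [B₀]
      map_add' x y := by simp only [B₀, map_add]; ring }
  have hBiter : ∀ (i : ℕ) (x : K), B^[i] x = HahnSeries.C (β ^ i) * B₀^[i] x := by
    intro i x
    induction i with
    | zero => simp
    | succ i ih =>
      rw [Function.iterate_succ_apply', Function.iterate_succ_apply', ih]
      change HahnSeries.C β * (s * sigma q _) = _ * (s * sigma q _)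
      rw [map_mul, sigma_C, pow_succ, map_mul]
      ring
  let x : ℕ → K := fun m => ∑ i ∈ Finset.range (m + 1), B^[i] (c (m - i) * B y)
  have hxk : x (k - 1) = y := by
    have hk : k - 1 + 1 = k := by obtain ⟨i, hi, -⟩ := hex; omega
    simp only [x, hk]
    refine Eq.trans (Finset.sum_congr rfl fun i _ => ?_) hsum
    have : c (k - 1 - i) * B y = HahnSeries.C β * ((c (k - 1 - i) * s) * sigma q y) := by
      change _ * (HahnSeries.C β * (s * sigma q y)) = _
      ring
    rw [hBiter, this, mul_comm (HahnSeries.C β), hB₀mul, hB₀mul,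
      (Function.iterate_fixed (sigma_C q β) i : (sigma q)^[i] _ = _),
      ← Function.iterate_succ_apply, pow_succ, map_mul]
    ring
  have hxs : ∀ m, x (m + 1) = B (x m) + c (m + 1) * B y := by
    intro m
    simp only [x]
    rw [Finset.sum_range_succ', map_sum]
    congr 1
    refine Finset.sum_congr rfl fun i _ => ?_
    rw [Function.iterate_succ_apply', Nat.add_sub_add_right]
  have haB : ∀ z, HahnSeries.C β⁻¹ * HahnSeries.single d 1 * B z = sigma q z := by
    intro z
    change _ * (HahnSeries.C β * (s * sigma q z)) = _
    have hC : (HahnSeries.C β⁻¹ * HahnSeries.C β : K) = 1 := by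
      rw [← map_mul, inv_mul_cancel₀ hβ, map_one]
    linear_combination (sigma q z) * hC * (HahnSeries.single d 1 : K) * s + (sigma q z) * hs
  refine ⟨HahnSeries.C β⁻¹ * HahnSeries.single d 1, ?_, x, by rwa [hxk], ?_, fun i => ?_⟩
  · exact mul_ne_zero (by simpa using hβ) (HahnSeries.single_ne_zero one_ne_zero)
  · rw [hxk, ← haB]
    simp [x]
    ring
  · rw [hxk, hxs, ← haB, ← haB]
    ring

/-! ### Ramification -/

theorem coeff_ramify_mul (l : ℕ+) (f : K) (m : ℤ) :
    (ramify l f).coeff (((l : ℕ) : ℤ) * m) = f.coeff m :=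
  HahnSeries.embDomain_coeff

theorem coeff_ramify_of_notMem (l : ℕ+) (f : K) {n : ℤ} (h : ¬ ((l : ℕ) : ℤ) ∣ n) :
    (ramify l f).coeff n = 0 := by
  apply HahnSeries.embDomain_of_notMem_range
  rintro ⟨m, hm⟩
  exact h ⟨m, hm.symm⟩

theorem order_ramify (l : ℕ+) (f : K) : (ramify l f).order = ((l : ℕ) : ℤ) * f.order := by
  by_cases hf : f = 0
  · simp [hf]
  have hf' : ramify l f ≠ 0 := by simpa using hf
  have hl : (0 : ℤ) < ((l : ℕ) : ℤ) := by simp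
  apply le_antisymm
  · apply HahnSeries.order_le_of_coeff_ne_zero
    rw [coeff_ramify_mul]
    exact HahnSeries.coeff_order_eq_zero.not.2 hf
  · have h := HahnSeries.coeff_order_eq_zero.not.2 hf'
    by_cases hd : ((l : ℕ) : ℤ) ∣ (ramify l f).order
    · obtain ⟨m, hm⟩ := hd
      rw [hm, coeff_ramify_mul] at h
      rw [hm]
      exact mul_le_mul_of_nonneg_left (HahnSeries.order_le_of_coeff_ne_zero h) hl.le
    · exact absurd (coeff_ramify_of_notMem l f hd) h

theorem ramify_ramify (l m : ℕ+) (f : K) : ramify m (ramify l f) = ramify (m * l) f := by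
  ext n
  have hm : ((m : ℕ) : ℤ) ≠ 0 := by simp
  by_cases h : ((m : ℕ) : ℤ) ∣ n
  · obtain ⟨n, rfl⟩ := h
    rw [coeff_ramify_mul]
    by_cases h : ((l : ℕ) : ℤ) ∣ n
    · obtain ⟨n, rfl⟩ := h
      rw [coeff_ramify_mul, ← mul_assoc, ← Nat.cast_mul, ← PNat.mul_coe, coeff_ramify_mul]
    · rw [coeff_ramify_of_notMem _ _ h, coeff_ramify_of_notMem]
      rwa [PNat.mul_coe, Nat.cast_mul, mul_dvd_mul_iff_left hm]
  · rw [coeff_ramify_of_notMem _ _ h, coeff_ramify_of_notMem]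
    rw [PNat.mul_coe, Nat.cast_mul]
    exact fun h' => h (dvd_of_mul_right_dvd h')

/-- The roots `q_{ml}`, as a compatible family of roots of `q_l`. -/
def RootSystem.shift {q : ℂˣ} (ρ : RootSystem q) (l : ℕ+) : RootSystem (ρ.root l) where
  root m := ρ.root (m * l)
  root_pow m := ρ.root_mul_pow m l
  root_mul_pow m m' := by rw [mul_assoc, ρ.root_mul_pow]

theorem RootSystem.one_lt_norm {q : ℂˣ} (ρ : RootSystem q) (hq : 1 < ‖(q : ℂ)‖) (l : ℕ+) :
    1 < ‖(ρ.root l : ℂ)‖ := by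
  by_contra! h
  have := pow_le_one₀ (n := l) (norm_nonneg _) h
  rw [← norm_pow, ← Units.val_pow_eq_pow_val, ρ.root_pow] at this
  linarith

/-- The relevant slope is the minimum of `ord c_{k-1-i} / (i + 1)`. If it is attained at `i₀`,
ramification of degree `i₀ + 1` makes it the integer `ord c_{k-1-i₀}`. -/
theorem exists_ramified_eigenvector_coordinates {q : ℂˣ} (hq : 1 < ‖(q : ℂ)‖) (ρ : RootSystem q)
    (k : ℕ) (c : ℕ → K) (hc : ∃ i < k, c i ≠ 0) :
    ∃ (l : ℕ+) (a : K), a ≠ 0 ∧ ∃ x : ℕ → K, x (k - 1) ≠ 0 ∧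
      a * x 0 = ramify l (c 0) * sigma (ρ.root l) (x (k - 1)) ∧
      ∀ i, a * x (i + 1) =
        sigma (ρ.root l) (x i) + ramify l (c (i + 1)) * sigma (ρ.root l) (x (k - 1)) := by
  classical
  let J := (Finset.range k).filter fun i => c (k - 1 - i) ≠ 0
  have hJ : J.Nonempty := by
    obtain ⟨i, hi, h⟩ := hc
    refine ⟨k - 1 - i, Finset.mem_filter.2 ⟨Finset.mem_range.2 (by omega), ?_⟩⟩
    rwa [show k - 1 - (k - 1 - i) = i by omega]
  obtain ⟨i₀, hi₀, hmin⟩ := J.exists_min_image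
    (fun i => ((c (k - 1 - i)).order : ℚ) / ((i + 1 : ℕ) : ℚ)) hJ
  obtain ⟨hi₀k, hi₀c⟩ := Finset.mem_filter.1 hi₀
  refine ⟨i₀.succPNat, exists_eigenvector_coordinates _ (ρ.one_lt_norm hq _) k
    (fun i => ramify _ (c i)) (c (k - 1 - i₀)).order (fun i hi h => ?_)
    ⟨i₀, Finset.mem_range.1 hi₀k, by simpa using hi₀c, ?_⟩⟩
  · have h' : c (k - 1 - i) ≠ 0 := by simpa using h
    have := hmin i (Finset.mem_filter.2 ⟨Finset.mem_range.2 hi, h'⟩)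
    rw [div_le_div_iff₀ (by positivity) (by positivity)] at this
    rw [order_ramify, Nat.succPNat_coe]
    have h2 : (c (k - 1 - i₀)).order * ((i + 1 : ℕ) : ℤ) ≤
      (c (k - 1 - i)).order * ((i₀ + 1 : ℕ) : ℤ) := by exact_mod_cast this
    push_cast at h2 ⊢
    linarith
  · rw [order_ramify, Nat.succPNat_coe]
    simp

open scoped Matrix

/-! ### Triangularization of matrices -/

theorem exists_minimal_dependence {F : Type u} [Field F] {V : Type v} [AddCommGroup V] [Module F V]
    [FiniteDimensional F V] (u : ℕ → V) : ∃ k : ℕ,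
      u k ∈ Submodule.span F (u '' Set.Iio k) ∧
      ∀ i < k, u i ∉ Submodule.span F (u '' Set.Iio i) := by
  classical
  have : ∃ k, u k ∈ Submodule.span F (u '' Set.Iio k) := by
    let W : ℕ →o Submodule F V :=
      ⟨fun k => Submodule.span F (u '' Set.Iio k), fun i j hij =>
        Submodule.span_mono (Set.image_mono (Set.Iio_subset_Iio hij))⟩
    obtain ⟨k, hk⟩ := monotone_stabilizes_iff_noetherian.2 (inferInstance : IsNoetherian F V) W
    refine ⟨k, ?_⟩
    have : W k = W (k + 1) := hk (k + 1) (Nat.le_succ k)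
    change u k ∈ W k
    rw [this]
    exact Submodule.subset_span ⟨k, Nat.lt_succ_self k, rfl⟩
  exact ⟨Nat.find this, Nat.find_spec this, fun i hi => Nat.find_min this hi⟩

theorem map_mulVec_comp {m n : Type*} [Fintype n] (f : K →+* K) (A : Matrix m n K) (x : n → K) :
    A.map f *ᵥ (f ∘ x) = f ∘ (A *ᵥ x) := by
  ext i
  simp [Matrix.mulVec, dotProduct]

/-- The iterates of one vector, up to their first linear dependence, form a basis of a cyclic
submodule, to which the coordinate equations apply. -/
theorem exists_matrix_eigenvector {q : ℂˣ} (hq : 1 < ‖(q : ℂ)‖) (ρ : RootSystem q) {n : ℕ}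
    (A : Matrix (Fin (n + 1)) (Fin (n + 1)) K) (hA : IsUnit A.det) :
    ∃ (l : ℕ+) (a : K) (v : Fin (n + 1) → K), a ≠ 0 ∧ v ≠ 0 ∧
      A.map (ramify l) *ᵥ (sigma (ρ.root l) ∘ v) = a • v := by
  let u : ℕ → Fin (n + 1) → K := fun i =>
    Nat.rec (Pi.single 0 1) (fun _ x => A *ᵥ (sigma q ∘ x)) i
  have hu0 : ∀ i, u i ≠ 0 := by
    intro i
    induction i with
    | zero => exact fun h => one_ne_zero (α := K) (by simpa [u] using congrFun h 0)
    | succ i ih =>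
      intro h
      change A *ᵥ (sigma q ∘ u i) = 0 at h
      have h2 := Matrix.eq_zero_of_mulVec_eq_zero hA.ne_zero h
      exact ih (funext fun j => by simpa using congrFun h2 j)
  obtain ⟨k, hk, hmin⟩ := exists_minimal_dependence (F := K) u
  have hIio : Set.Iio k = (Finset.range k : Set ℕ) := by ext; simp
  rw [hIio, Submodule.mem_span_image_finset_iff_exists_fun'] at hk
  obtain ⟨c, hc⟩ := hk
  have hcne : ∃ i < k, c i ≠ 0 := by
    by_contra! h
    apply hu0 k
    rw [← hc]
    exact Finset.sum_eq_zero fun i hi => by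
      rw [h i (Finset.mem_range.1 hi)]
      exact zero_smul K (u i)
  have hk0 : k - 1 + 1 = k := by obtain ⟨i, hi, -⟩ := hcne; omega
  -- The image of `f` over `K_l` reads off `x (k - 1)` up to a nonzero factor, so the eigenvector is
  -- nonzero without any appeal to independence over `K_l`.
  obtain ⟨f, hf, hf0⟩ := Submodule.exists_dual_map_eq_bot_of_notMem (hmin (k - 1) (by omega))
    inferInstance
  have hf0' : ∀ i < k - 1, f (u i) = 0 := fun i hi => by
    have : f (u i) ∈ (Submodule.span K (u '' Set.Iio (k - 1))).map f :=
      Submodule.mem_map_of_mem (Submodule.subset_span ⟨i, hi, rfl⟩)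
    rw [hf0] at this
    exact this
  obtain ⟨l, a, ha, x, hx, hx0, hxs⟩ := exists_ramified_eigenvector_coordinates hq ρ k c hcne
  set τ := sigma (ρ.root l)
  let v : ℕ → Fin (n + 1) → K := fun i => ramify l ∘ u i
  have hv : ∀ i, A.map (ramify l) *ᵥ (τ ∘ v i) = v (i + 1) := by
    intro i
    have : τ ∘ v i = ramify l ∘ (sigma q ∘ u i) := funext fun j => sigma_ramify ρ l _
    rw [this, map_mulVec_comp]
  have hvk : v k = ∑ i ∈ Finset.range k, ramify l (c i) • v i := by
    ext1 j
    simp only [v, Function.comp_apply, ← hc, Finset.sum_apply, Pi.smul_apply, smul_eq_mul,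
      map_sum, map_mul]
  refine ⟨l, a, ∑ i ∈ Finset.range k, x i • v i, ha, fun h => ?_, ?_⟩
  · have h1 : ∀ i, ∑ j, ramify l (f (Pi.single j 1)) * v i j = ramify l (f (u i)) := by
      intro i
      rw [LinearMap.pi_apply_eq_sum_univ f (u i), map_sum]
      refine Finset.sum_congr rfl fun j _ => ?_
      rw [smul_eq_mul, map_mul, mul_comm]
      congr 3
      ext j'
      simp [Pi.single_apply, eq_comm]
    have h2 : ∑ j, ramify l (f (Pi.single j 1)) * (∑ i ∈ Finset.range k, x i • v i) j = 0 := by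
      rw [h]
      simp
    simp only [Finset.sum_apply, Pi.smul_apply, smul_eq_mul, Finset.mul_sum] at h2
    rw [Finset.sum_comm] at h2
    simp only [mul_left_comm _ (x _), ← Finset.mul_sum, h1] at h2
    rw [← hk0, Finset.sum_range_succ, Finset.sum_eq_zero, zero_add] at h2
    · rcases mul_eq_zero.1 h2 with h2 | h2
      · exact hx h2
      · exact hf ((map_eq_zero _).1 h2)
    · intro i hi
      rw [hf0' i (Finset.mem_range.1 hi), map_zero, mul_zero]
  · have h1 : τ ∘ (∑ i ∈ Finset.range k, x i • v i) = ∑ i ∈ Finset.range k, τ (x i) • (τ ∘ v i) := by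
      ext1 j
      simp [Finset.sum_apply]
    rw [h1, Matrix.mulVec_sum]
    simp only [Matrix.mulVec_smul, hv, Finset.smul_sum, smul_smul]
    conv_lhs => rw [← hk0, Finset.sum_range_succ, hk0, hvk, Finset.smul_sum]
    conv_rhs => rw [← hk0, Finset.sum_range_succ']
    rw [hx0]
    conv_lhs => rw [← hk0, Finset.sum_range_succ']
    rw [hk0]
    ext1 j
    simp only [hxs, Pi.add_apply, Finset.sum_apply, Pi.smul_apply, smul_eq_mul, add_mul,
      Finset.sum_add_distrib]
    have h2 : ∀ i, τ (x (k - 1)) * (ramify l (c i) * v i j) =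
        ramify l (c i) * τ (x (k - 1)) * v i j := fun i => by ring
    simp only [h2]
    ring

theorem exists_matrix_first_column {F : Type u} [Field F] {n : ℕ} {v : Fin (n + 1) → F}
    (hv : v ≠ 0) : ∃ P : Matrix (Fin (n + 1)) (Fin (n + 1)) F, IsUnit P.det ∧ ∀ i, P i 0 = v i := by
  obtain ⟨N, hN⟩ := Submodule.exists_isCompl (F ∙ v)
  have hdim : Module.finrank F N = n := by
    have := Submodule.finrank_add_eq_of_isCompl hN
    rw [finrank_span_singleton hv, Module.finrank_fin_fun] at this
    omega
  let b := Module.Basis.mkFinCons v (Module.finBasisOfFinrankEq F N hdim)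
    (fun c x hx h => by
      have h1 : c • v ∈ N := by
        rw [eq_neg_of_add_eq_zero_left h]; exact neg_mem hx
      have h2 := Submodule.disjoint_def.1 hN.disjoint (c • v)
        (Submodule.smul_mem _ _ (Submodule.mem_span_singleton_self v)) h1
      exact (smul_eq_zero.1 h2).resolve_right hv)
    (fun z => by
      obtain ⟨y, hy, x, hx, rfl⟩ := Submodule.mem_sup.1
        (hN.sup_eq_top ▸ Submodule.mem_top : z ∈ (F ∙ v) ⊔ N)
      obtain ⟨c, rfl⟩ := Submodule.mem_span_singleton.1 hy
      exact ⟨-c, by rw [neg_smul, add_neg_cancel_comm]; exact hx⟩)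
  refine ⟨(Pi.basisFun F _).toMatrix b, ?_, fun i => ?_⟩
  · have := (Pi.basisFun F (Fin (n + 1))).isUnit_det b
    rwa [Module.Basis.det_apply] at this
  · simp [Module.Basis.toMatrix_apply, b]

/-- An eigenvector as first column splits off a triangular block, and induction treats the remaining
block. Since that block lives over `K_l` with parameter `q_l`, both `q` and the root system vary in
the induction, and ramification degrees multiply. -/
theorem exists_matrix_triangularization (n : ℕ) : ∀ {q : ℂˣ} (_ : 1 < ‖(q : ℂ)‖) (ρ : RootSystem q)
    (A : Matrix (Fin n) (Fin n) K), IsUnit A.det →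
    ∃ (l : ℕ+) (P U : Matrix (Fin n) (Fin n) K), IsUnit P.det ∧ (∀ i j, j < i → U i j = 0) ∧
      (∀ j, U j j ≠ 0) ∧ A.map (ramify l) * P.map (sigma (ρ.root l)) = P * U := by
  induction n with
  | zero =>
    intro q _ ρ A _
    exact ⟨1, 1, 0, by simp, fun i => i.elim0, fun i => i.elim0, by ext i; exact i.elim0⟩
  | succ n ih =>
    intro q hq ρ A hA
    obtain ⟨l, a, v, ha, hv, hAv⟩ := exists_matrix_eigenvector hq ρ A hA
    obtain ⟨P₁, hP₁, hcol⟩ := exists_matrix_first_column hv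
    let A₁ := P₁⁻¹ * (A.map (ramify l) * P₁.map (sigma (ρ.root l)))
    have hA₁ : A.map (ramify l) * P₁.map (sigma (ρ.root l)) = P₁ * A₁ := by
      rw [← Matrix.mul_assoc, Matrix.mul_nonsing_inv _ hP₁, Matrix.one_mul]
    have hA₁col : ∀ i, A₁ i 0 = a * (1 : Matrix (Fin (n + 1)) (Fin (n + 1)) K) i 0 := by
      have h1 : (A.map (ramify l) * P₁.map (sigma (ρ.root l))).col 0 = a • P₁.col 0 := by
        have : P₁.col 0 = v := funext hcol
        rw [this, ← hAv, ← this]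
        rfl
      intro i
      have h2 : A₁.col 0 = P₁⁻¹ *ᵥ (a • P₁.col 0) := by rw [← h1]; rfl
      have h3 : P₁⁻¹ *ᵥ (P₁.col 0) = (1 : Matrix (Fin (n + 1)) (Fin (n + 1)) K).col 0 := by
        rw [← Matrix.nonsing_inv_mul _ hP₁]; rfl
      rw [Matrix.mulVec_smul, h3] at h2
      exact congrFun h2 i
    have h00 : A₁ 0 0 = a := by simp [hA₁col]
    have hs0 : ∀ i : Fin n, A₁ i.succ 0 = 0 := fun i => by simp [hA₁col]
    let B := A₁.submatrix Fin.succ Fin.succ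
    have hdet : A₁.det = a * B.det := by
      rw [Matrix.det_succ_column_zero, Fin.sum_univ_succ]
      simp [h00, hs0, B]
    have hmapdet : ∀ (f : K →+* K) (C : Matrix (Fin (n + 1)) (Fin (n + 1)) K), IsUnit C.det →
        IsUnit (C.map f).det := fun f C hC => by
      have := RingHom.map_det f C
      rw [RingHom.mapMatrix_apply] at this
      rw [← this]
      exact hC.map f
    have hB : IsUnit B.det := by
      have h1 : IsUnit (P₁ * A₁).det := by
        rw [← hA₁, Matrix.det_mul]
        exact (hmapdet _ A hA).mul (hmapdet (sigma (ρ.root l) : K →+* K) P₁ hP₁)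
      rw [Matrix.det_mul, hdet] at h1
      exact isUnit_of_mul_isUnit_right (isUnit_of_mul_isUnit_right h1)
    obtain ⟨m, P₂, U₂, hP₂, hU₂, hU₂d, hPU⟩ := ih (ρ.one_lt_norm hq l) (ρ.shift l) B hB
    set τ := sigma ((ρ.shift l).root m)
    let D : Matrix (Fin (n + 1)) (Fin (n + 1)) K := Matrix.of
      (Fin.cases (Fin.cases 1 fun _ => 0) fun i => Fin.cases 0 fun j => P₂ i j)
    let U : Matrix (Fin (n + 1)) (Fin (n + 1)) K := Matrix.of
      (Fin.cases (Fin.cases (ramify m a) fun j => ∑ k, ramify m (A₁ 0 k.succ) * τ (P₂ k j))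
        fun i => Fin.cases 0 fun j => U₂ i j)
    have hD : D.det = P₂.det := by
      rw [Matrix.det_succ_column_zero, Fin.sum_univ_succ]
      have : D.submatrix Fin.succ Fin.succ = P₂ := by ext i j; rfl
      simp [D] at this ⊢
      simp [this]
    have hDU : A₁.map (ramify m) * D.map τ = D * U := by
      refine Matrix.ext fun i j => ?_
      rw [Matrix.mul_apply, Matrix.mul_apply, Fin.sum_univ_succ, Fin.sum_univ_succ]
      refine Fin.cases ?_ (fun i => ?_) i <;> refine Fin.cases ?_ (fun j => ?_) j
      · simp [D, U, h00]
      · simp [D, U]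
      · simp [D, U, hs0]
      · have := congrFun (congrFun hPU i) j
        rw [Matrix.mul_apply, Matrix.mul_apply] at this
        simpa [D, U, hs0, B] using this
    refine ⟨m * l, P₁.map (ramify m) * D, U, ?_, ?_, ?_, ?_⟩
    · rw [Matrix.det_mul, hD]
      exact (hmapdet _ _ hP₁).mul hP₂
    · intro i j
      refine Fin.cases ?_ (fun i => ?_) i <;> refine Fin.cases ?_ (fun j => ?_) j
      · simp
      · simp
      · simp [U]
      · intro h; exact hU₂ i j (Fin.succ_lt_succ_iff.1 h)
    · refine Fin.cases ?_ fun j => ?_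
      · simpa [U] using ha
      · exact hU₂d j
    · change A.map (ramify (m * l)) * (P₁.map (ramify m) * D).map τ = _
      have e1 : A.map (ramify (m * l)) = (A.map (ramify l)).map (ramify m) := by
        ext1 i j; exact (ramify_ramify l m _).symm
      have e2 : (P₁.map (ramify m)).map τ = (P₁.map (sigma (ρ.root l))).map (ramify m) := by
        ext1 i j; exact sigma_ramify (ρ.shift l) m _
      have e3 : (P₁.map (ramify m) * D).map τ = (P₁.map (ramify m)).map τ * D.map τ :=
        Matrix.map_mul (f := (τ : K →+* K))
      rw [e1, e3, e2, ← Matrix.mul_assoc, ← Matrix.map_mul, hA₁, Matrix.map_mul, Matrix.mul_assoc,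
        hDU, Matrix.mul_assoc]

theorem exists_basis_of_isUnit_det {F : Type u} [Field F] {V : Type v} [AddCommGroup V] [Module F V]
    {n : ℕ} (e : Module.Basis (Fin n) F V) (P : Matrix (Fin n) (Fin n) F) (hP : IsUnit P.det) :
    ∃ b : Module.Basis (Fin n) F V, ∀ j, b j = ∑ i, P i j • e i :=
  ⟨e.map (Matrix.toLinearEquiv e P hP), fun j => by
    rw [Module.Basis.map_apply]
    exact Matrix.toLin_self e e P j⟩

/-! ### Extension of scalars for subspaces -/

section FieldExtension

variable {F : Type*} {L : Type*} [Field F] [Field L] [Algebra F L] {M : Type v} [AddCommGroup M]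
  [Module F M]

theorem one_tmul_eq_sum {ι : Type*} [Fintype ι] (e : Module.Basis ι F M) (x : M) :
    (1 : L) ⊗ₜ[F] x = ∑ i, algebraMap F L (e.repr x i) • ((1 : L) ⊗ₜ[F] e i) := by
  conv_lhs => rw [← e.sum_repr x, TensorProduct.tmul_sum]
  refine Finset.sum_congr rfl fun i _ => ?_
  rw [TensorProduct.tmul_smul, algebraMap_smul]

theorem finrank_le_of_one_tmul_mem [FiniteDimensional F M] {N : Submodule F M}
    {W : Submodule L (L ⊗[F] M)} (h : ∀ x ∈ N, (1 : L) ⊗ₜ[F] x ∈ W) :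
    Module.finrank F N ≤ Module.finrank L W := by
  let f : L ⊗[F] N →ₗ[L] L ⊗[F] M := N.subtype.baseChange L
  have hf : Function.Injective f :=
    Module.Flat.lTensor_preserves_injective_linearMap (M := L) N.subtype N.subtype_injective
  have hmem : ∀ x, f x ∈ W := by
    intro x
    induction x with
    | zero => rw [map_zero]; exact zero_mem _
    | add x y hx hy => rw [map_add]; exact add_mem hx hy
    | tmul c x =>
      have : f (c ⊗ₜ x) = c • ((1 : L) ⊗ₜ[F] (x : M)) := by
        rw [TensorProduct.smul_tmul', smul_eq_mul, mul_one]; rfl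
      rw [this]
      exact Submodule.smul_mem _ _ (h x x.2)
  have := LinearMap.finrank_le_finrank_of_injective (f := f.codRestrict W hmem)
    (fun x y h => hf (congrArg Subtype.val h))
  rwa [Module.finrank_baseChange] at this

end FieldExtension

/-! ### The ramified extensions as valued difference fields -/

/-- The absolute value `exp (- ord_z f)` on `K`. -/
abbrev baseAbs (q : ℂˣ) : InvariantAbs (sigma q) := laurentAbs q 1 one_pos

/-- The absolute value `exp (- ord_z f)` on `K_l`. -/
def ramAbs {q : ℂˣ} (ρ : RootSystem q) (l : ℕ+) : InvariantAbs (sigmaRam ρ l) :=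
  laurentAbs (ρ.root l) (((l : ℕ) : ℝ)⁻¹) (by simp)

theorem ramAbs_apply {q : ℂˣ} (ρ : RootSystem q) (l : ℕ+) {a : Ramified l} (ha : a ≠ 0) :
    (ramAbs ρ l).abs a = Real.exp (-(((val l a : ℚ) / ((l : ℕ) : ℚ) : ℚ) : ℝ)) := by
  refine (laurentAbs_apply (f := (a : K)) ha).trans ?_
  push_cast
  rw [div_eq_inv_mul]
  rfl

theorem ramAbs_algebraMap {q : ℂˣ} (ρ : RootSystem q) (l : ℕ+) (f : K) :
    (ramAbs ρ l).abs (algebraMap K (Ramified l) f) = (baseAbs q).abs f := by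
  by_cases hf : f = 0
  · rw [hf, map_zero, AbsoluteValue.map_zero, AbsoluteValue.map_zero]
  · have hf' : ramify l f ≠ 0 := by simpa using hf
    refine (laurentAbs_apply (q := ρ.root l) (f := ramify l f) hf').trans ?_
    rw [laurentAbs_apply hf, order_ramify]
    push_cast
    rw [one_mul, inv_mul_cancel_left₀ (by simp)]

theorem solvesRankOne_ramAbs {q : ℂˣ} (ρ : RootSystem q) (l : ℕ+) :
    DiffModule.SolvesRankOne (ramAbs ρ l) :=
  solvesRankOne_laurentAbs (ρ.root l) _ _

/-! ### The retraction of `K_l` onto `K` -/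

/-- The series in `z` made of the monomials of a series in `z_l` that are powers of `z`. -/
def contract (l : ℕ+) (f : K) : K where
  coeff n := f.coeff (((l : ℕ) : ℤ) * n)
  isPWO_support' := by
    rw [Set.isPWO_iff_exists_monotone_subseq]
    intro s hs
    obtain ⟨g, hg⟩ := Set.isPWO_iff_exists_monotone_subseq.1 f.isPWO_support
      (fun n => ((l : ℕ) : ℤ) * s n) hs
    exact ⟨g, fun i j hij => le_of_mul_le_mul_left (hg hij) (by simp)⟩

theorem coeff_contract (l : ℕ+) (f : K) (n : ℤ) :
    (contract l f).coeff n = f.coeff (((l : ℕ) : ℤ) * n) := rfl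

theorem contract_ramify_mul (l : ℕ+) (c f : K) : contract l (ramify l c * f) = c * contract l f := by
  have hl : ((l : ℕ) : ℤ) ≠ 0 := by simp
  ext n
  rw [coeff_contract, HahnSeries.coeff_mul, HahnSeries.coeff_mul]
  symm
  refine Finset.sum_bij (fun x _ => (((l : ℕ) : ℤ) * x.1, ((l : ℕ) : ℤ) * x.2)) ?_ ?_ ?_ ?_
  · intro x hx
    rw [Finset.mem_antidiagonal] at hx ⊢
    refine ⟨?_, hx.2.1, ?_⟩
    · rw [HahnSeries.mem_support, coeff_ramify_mul]
      exact hx.1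
    · rw [← hx.2.2, mul_add]
  · intro x _ y _ h
    rw [Prod.mk.injEq] at h
    exact Prod.ext (mul_left_cancel₀ hl h.1) (mul_left_cancel₀ hl h.2)
  · rintro ⟨i, j⟩ hx
    rw [Finset.mem_antidiagonal] at hx
    obtain ⟨h1, h2, h3⟩ := hx
    have hd : ((l : ℕ) : ℤ) ∣ i := by
      by_contra hd
      exact h1 (coeff_ramify_of_notMem l c hd)
    obtain ⟨i, rfl⟩ := hd
    have hj : j = ((l : ℕ) : ℤ) * (n - i) := by
      simp only at h3
      rw [mul_sub, ← h3]; ring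
    subst hj
    refine ⟨(i, n - i), Finset.mem_antidiagonal.2 ⟨?_, h2, by simp⟩, rfl⟩
    rw [HahnSeries.mem_support, coeff_ramify_mul] at h1
    exact h1
  · intro x _
    rw [coeff_ramify_mul, coeff_contract]

/-- `contract` as a `K`-linear retraction of `K → K_l`. -/
def contractLin (l : ℕ+) : Ramified l →ₗ[K] K where
  toFun := contract l
  map_add' _ _ := by ext n; rfl
  map_smul' c f := by
    rw [Algebra.smul_def]
    exact contract_ramify_mul l c f

theorem contractLin_one (l : ℕ+) : contractLin l 1 = 1 := by
  have := contract_ramify_mul l 1 1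
  rw [map_one, one_mul, one_mul] at this
  ext n
  change (1 : K).coeff (((l : ℕ) : ℤ) * n) = (1 : K).coeff n
  rw [HahnSeries.coeff_one, HahnSeries.coeff_one]
  simp

theorem contractLin_sigmaRam {q : ℂˣ} (ρ : RootSystem q) (l : ℕ+) (f : Ramified l) :
    contractLin l (sigmaRam ρ l f) = sigma q (contractLin l f) := by
  ext n
  rw [coeff_sigma]
  change ((ρ.root l ^ (((l : ℕ) : ℤ) * n) : ℂˣ) : ℂ) * _ = _
  rw [zpow_mul, zpow_natCast, ρ.root_pow]
  rfl

/-- Discarding monomials cannot lower the order, and both absolute values are normalized by the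
order in `z`. -/
theorem abs_contractLin_le {q : ℂˣ} (ρ : RootSystem q) (l : ℕ+) (f : Ramified l) :
    (baseAbs q).abs (contractLin l f) ≤ (ramAbs ρ l).abs f := by
  by_cases h : contractLin l f = 0
  · rw [h, AbsoluteValue.map_zero]
    exact AbsoluteValue.nonneg _ _
  have hf : f ≠ 0 := by rintro rfl; exact h (map_zero _)
  rw [laurentAbs_apply h]
  refine le_of_le_of_eq ?_ (laurentAbs_apply (q := ρ.root l) (f := (f : K)) hf).symm
  have h1 := HahnSeries.coeff_order_eq_zero.not.2 h
  have h2 : HahnSeries.order (f : K) ≤ ((l : ℕ) : ℤ) * (contractLin l f).order :=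
    HahnSeries.order_le_of_coeff_ne_zero h1
  rw [Real.exp_le_exp, neg_le_neg_iff, one_mul, inv_mul_le_iff₀ (by simp)]
  exact_mod_cast h2

/-! ### Triangularization over `K_l`, and passage of slope parts between `K` and `K_l` -/

namespace DiffModule

variable {q : ℂˣ} {M : Type v} [AddCommGroup M] [Module K M]

theorem baseChange_tmul (S : DiffModule K (sigma q) M) (ρ : RootSystem q) (l : ℕ+)
    (f : Ramified l) (x : M) : (S.baseChange ρ l).Φ (f ⊗ₜ x) = sigmaRam ρ l f ⊗ₜ S.Φ x := rfl

theorem isUnit_det_matrix {n : ℕ} (S : DiffModule K (sigma q) M) (e : Module.Basis (Fin n) K M) :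
    IsUnit (Matrix.of fun i j => e.repr (S.Φ (e j)) i).det := by
  rw [isUnit_iff_ne_zero]
  intro h
  obtain ⟨x, hx, hx0⟩ := Matrix.exists_mulVec_eq_zero_iff.2 h
  -- By semilinearity, a kernel vector of the matrix must be twisted by `σ⁻¹` to give a kernel
  -- vector of `Φ`.
  have : S.Φ (∑ j, (sigma q).symm (x j) • e j) = 0 := by
    apply e.repr.injective
    ext1 i
    rw [map_sum, map_sum, Finsupp.finsetSum_apply]
    refine Eq.trans ?_ (congrArg (fun f => f i) (map_zero e.repr)).symm
    refine Eq.trans (Finset.sum_congr rfl fun j _ => ?_) (congrFun hx0 i)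
    rw [map_smulₛₗ, map_smul, Finsupp.smul_apply, smul_eq_mul, mul_comm]
    change _ * sigma q ((sigma q).symm (x j)) = _
    rw [RingEquiv.apply_symm_apply]
    rfl
  rw [← map_zero S.Φ] at this
  have h0 := S.bijective.1 this
  apply hx
  ext1 i
  have := Fintype.linearIndependent_iff.1 e.linearIndependent _ h0 i
  simpa using this

theorem exists_isTriangular [FiniteDimensional K M] (S : DiffModule K (sigma q) M)
    (hq : 1 < ‖(q : ℂ)‖) (ρ : RootSystem q) :
    ∃ (l : ℕ+) (n : ℕ) (b : Module.Basis (Fin n) (Ramified l) (Ramified l ⊗[K] M))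
      (a : Fin n → Ramified l), (S.baseChange ρ l).IsTriangular b a := by
  let e := Module.finBasis K M
  set n := Module.finrank K M
  let A : Matrix (Fin n) (Fin n) K := Matrix.of fun i j => e.repr (S.Φ (e j)) i
  -- `Ramified l` is `K` by definition, so the matrix statement applies verbatim.
  have key : ∃ (l : ℕ+) (P U : Matrix (Fin n) (Fin n) (Ramified l)), IsUnit P.det ∧
      (∀ i j, j < i → U i j = 0) ∧ (∀ j, U j j ≠ 0) ∧
      A.map (algebraMap K (Ramified l)) * P.map (sigmaRam ρ l) = P * U :=
    exists_matrix_triangularization n hq ρ A (S.isUnit_det_matrix e)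
  obtain ⟨l, P, U, hP, hU, hUd, hAP⟩ := key
  let e' := e.baseChange (Ramified l)
  obtain ⟨b, hb⟩ := exists_basis_of_isUnit_det e' P hP
  have he' : ∀ j, (S.baseChange ρ l).Φ (e' j) = ∑ i, algebraMap K (Ramified l) (A i j) • e' i := by
    intro j
    simp only [e', Module.Basis.baseChange_apply, baseChange_tmul, map_one]
    exact one_tmul_eq_sum e _
  have hΦb : ∀ j, (S.baseChange ρ l).Φ (b j) = ∑ i, U i j • b i := by
    intro j
    simp only [hb, map_sum, map_smulₛₗ, he', Finset.smul_sum, smul_smul]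
    rw [Finset.sum_comm]
    conv_rhs => rw [Finset.sum_comm]
    refine Finset.sum_congr rfl fun i _ => ?_
    rw [← Finset.sum_smul, ← Finset.sum_smul]
    congr 1
    have := congrFun (congrFun hAP i) j
    rw [Matrix.mul_apply, Matrix.mul_apply] at this
    simp only [mul_comm (U _ _)]
    rw [← this]
    exact Finset.sum_congr rfl fun k _ => mul_comm _ _
  refine ⟨l, n, b, fun j => U j j, fun j => ⟨hUd j, ?_⟩⟩
  rw [hΦb, ← Finset.add_sum_erase _ _ (Finset.mem_univ j), add_sub_cancel_left]
  refine Submodule.sum_mem _ fun i hi => ?_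
  rcases lt_or_gt_of_ne (Finset.ne_of_mem_erase hi) with h | h
  · exact Submodule.smul_mem _ _ (Submodule.subset_span ⟨i, h, rfl⟩)
  · rw [hU i j h, zero_smul]
    exact zero_mem _

theorem one_tmul_mem_slopePart [FiniteDimensional K M] {S : DiffModule K (sigma q) M}
    (ρ : RootSystem q) (l : ℕ+) {r : ℝ} {x : M} (hx : x ∈ S.slopePart (baseAbs q) r) :
    (1 : Ramified l) ⊗ₜ[K] x ∈ (S.baseChange ρ l).slopePart (ramAbs ρ l) r := by
  obtain ⟨u, hu, rfl, h⟩ := hx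
  refine ⟨fun n => (1 : Ramified l) ⊗ₜ u n, fun n => ?_, rfl, fun φ => ?_⟩
  · simp only
    rw [baseChange_tmul, map_one, hu n]
  · let e := Module.finBasis K M
    choose C hC using fun i => h (e.coord i)
    refine ⟨∑ i, C i * (ramAbs ρ l).abs (φ (1 ⊗ₜ e i)), fun n => ?_⟩
    have hφ : φ ((1 : Ramified l) ⊗ₜ u n) =
        ∑ i, algebraMap K (Ramified l) (e.coord i (u n)) * φ (1 ⊗ₜ e i) := by
      rw [one_tmul_eq_sum e, map_sum]
      exact Finset.sum_congr rfl fun i _ => map_smul _ _ _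
    rw [hφ, Finset.sum_mul]
    refine (AbsoluteValue.sum_le _ _ _).trans (Finset.sum_le_sum fun i _ => ?_)
    rw [map_mul, ramAbs_algebraMap, mul_right_comm]
    exact mul_le_mul_of_nonneg_right (hC i n) (AbsoluteValue.nonneg _ _)

/-- The retraction `K_l ⊗ M → M` induced by `contractLin`. -/
def contractTensor (M : Type v) [AddCommGroup M] [Module K M] (l : ℕ+) :
    Ramified l ⊗[K] M →ₗ[K] M :=
  TensorProduct.lid K M ∘ₗ (contractLin l).rTensor M

theorem contractTensor_tmul (l : ℕ+) (f : Ramified l) (x : M) :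
    contractTensor M l (f ⊗ₜ x) = contractLin l f • x := rfl

/-- The retraction commutes with `Φ`, and a form `φ` composed with it equals `contractLin` applied
to the extension of `φ` to `K_l`; growth bounds therefore descend. -/
theorem contractTensor_mem_slopePart {S : DiffModule K (sigma q) M}
    (ρ : RootSystem q) (l : ℕ+) {r : ℝ} {x : Ramified l ⊗[K] M}
    (hx : x ∈ (S.baseChange ρ l).slopePart (ramAbs ρ l) r) :
    contractTensor M l x ∈ S.slopePart (baseAbs q) r := by
  have hΦ : ∀ y, contractTensor M l ((S.baseChange ρ l).Φ y) = S.Φ (contractTensor M l y) := by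
    intro y
    induction y with
    | zero => simp
    | add y z hy hz => rw [map_add, map_add, hy, hz, map_add, map_add]
    | tmul f y =>
      rw [baseChange_tmul, contractTensor_tmul, contractTensor_tmul, contractLin_sigmaRam,
        map_smulₛₗ]
      rfl
  obtain ⟨u, hu, rfl, h⟩ := hx
  refine ⟨fun n => contractTensor M l (u n), fun n => ?_, rfl, fun φ => ?_⟩
  · simp only
    rw [hu n, hΦ]
  · let ψ : Ramified l ⊗[K] M →ₗ[Ramified l] Ramified l :=
      (TensorProduct.AlgebraTensorModule.rid K (Ramified l) (Ramified l)).toLinearMap ∘ₗ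
        φ.baseChange (Ramified l)
    have hψ : ∀ y, φ (contractTensor M l y) = contractLin l (ψ y) := by
      intro y
      induction y with
      | zero => simp
      | add y z hy hz => rw [map_add, map_add, hy, hz, map_add, map_add]
      | tmul f y =>
        have : ψ (f ⊗ₜ y) = φ y • f := by
          simp [ψ]
        rw [contractTensor_tmul, this, map_smul, map_smul, smul_eq_mul, smul_eq_mul, mul_comm]
    obtain ⟨C, hC⟩ := h ψ
    refine ⟨C, fun n => ?_⟩
    rw [hψ]
    exact (abs_contractLin_le ρ l _).trans (hC n)

theorem finrank_slopePart_le_baseChange [FiniteDimensional K M] (S : DiffModule K (sigma q) M)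
    (ρ : RootSystem q) (l : ℕ+) (r : ℝ) : Module.finrank K (S.slopePart (baseAbs q) r) ≤
      Module.finrank (Ramified l) ((S.baseChange ρ l).slopePart (ramAbs ρ l) r) :=
  finrank_le_of_one_tmul_mem fun _ hx => one_tmul_mem_slopePart ρ l hx

end DiffModule

/-- The direct sum of the `p i` maps onto `V` and has dimension at most `∑ c i = dim V`, so the map
is bijective and every bound is attained. -/
theorem finrank_eq_and_iSupIndep_of_le {F : Type u} [Field F] {V : Type v} [AddCommGroup V]
    [Module F V] [FiniteDimensional F V] {ι : Type*} (p : ι → Submodule F V) (c : ι → ℕ)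
    (T : Finset ι) (hle : ∀ i, Module.finrank F (p i) ≤ c i) (hT : ∀ i ∉ T, c i = 0)
    (htop : ⨆ i, p i = ⊤) (hsum : ∑ i ∈ T, c i = Module.finrank F V) :
    (∀ i, Module.finrank F (p i) = c i) ∧ iSupIndep p := by
  classical
  have hbot : ∀ i ∉ T, p i = ⊥ := fun i hi =>
    Submodule.finrank_eq_zero.1 (Nat.le_zero.1 (hT i hi ▸ hle i))
  let p' : T → Submodule F V := fun i => p i
  have htop' : ⨆ i, p' i = ⊤ := by
    rw [eq_top_iff, ← htop]
    refine iSup_le fun i => ?_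
    by_cases hi : i ∈ T
    · exact le_iSup p' ⟨i, hi⟩
    · rw [hbot i hi]; exact bot_le
  let f : DirectSum T (fun i => p' i) →ₗ[F] V := DFinsupp.lsum ℕ fun i => (p' i).subtype
  have hf : Function.Surjective f := by
    rw [← LinearMap.range_eq_top, ← htop']
    exact (Submodule.iSup_eq_range_dfinsupp_lsum p').symm
  have hdim : Module.finrank F (DirectSum T fun i => p' i) = ∑ i ∈ T, Module.finrank F (p i) := by
    rw [Module.finrank_directSum, ← Finset.sum_coe_sort T]
  have h1 := LinearMap.finrank_le_finrank_of_surjective hf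
  have h2 := Finset.sum_le_sum fun i (_ : i ∈ T) => hle i
  have h3 : ∑ i ∈ T, Module.finrank F (p i) = ∑ i ∈ T, c i := by omega
  refine ⟨fun i => ?_, ?_⟩
  · by_cases hi : i ∈ T
    · exact (Finset.sum_eq_sum_iff_of_le fun i _ => hle i).1 h3 i hi
    · have := hle i
      have := hT i hi
      omega
  · have hinj : Function.Injective f :=
      (LinearMap.injective_iff_surjective_of_finrank_eq_finrank (by omega)).2 hf
    have hind : iSupIndep p' := iSupIndep_of_dfinsupp_lsum_injective p' hinj
    rw [← iSupIndep_ne_bot]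
    exact hind.comp (f := fun i : {i // p i ≠ ⊥} =>
      (⟨i.1, by by_contra h; exact i.2 (hbot _ h)⟩ : T)) fun i j h =>
        Subtype.ext (congrArg (fun t : T => t.1) h)

/-! ### Slope parts over `K`, slopes and purity -/

namespace DiffModule

variable {q : ℂˣ} {M : Type v} [AddCommGroup M] [Module K M]

/-- The part of slope `μ` of a `q`-difference module. -/
def part (S : DiffModule K (sigma q) M) (μ : ℚ) : Submodule K M :=
  S.slopePart (baseAbs q) (Real.exp (-(μ : ℝ)))

theorem isStable_part (S : DiffModule K (sigma q) M) (μ : ℚ) : S.IsStable (S.part μ) :=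
  isStable_slopePart (Real.exp_pos _)

/-- Decompose `1 ⊗ x` into slope parts over `K_l` and apply the retraction, which sends it back to
`x`. -/
theorem IsTriangular.iSup_part_eq_top {S : DiffModule K (sigma q) M} {ρ : RootSystem q} {l : ℕ+}
    {n : ℕ} {b : Module.Basis (Fin n) (Ramified l) (Ramified l ⊗[K] M)} {a : Fin n → Ramified l}
    (h : (S.baseChange ρ l).IsTriangular b a) : ⨆ μ, S.part μ = ⊤ := by
  rw [eq_top_iff]
  intro x _
  have hx : contractTensor M l (1 ⊗ₜ x) = x := by
    rw [contractTensor_tmul, contractLin_one, one_smul]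
  rw [← hx]
  refine Submodule.iSup_induction _
    (motive := fun y => contractTensor M l y ∈ ⨆ μ, S.part μ)
    (h.mem_iSup_slopePart (solvesRankOne_ramAbs ρ l) (1 ⊗ₜ x)) ?_ ?_ ?_
  · intro j y hy
    rw [ramAbs_apply ρ l (h j).1] at hy
    exact Submodule.mem_iSup_of_mem _ (contractTensor_mem_slopePart ρ l hy)
  · rw [map_zero]
    exact zero_mem _
  · intro y z hy hz
    rw [map_add]
    exact add_mem hy hz

theorem IsTriangular.finrank_part_le [FiniteDimensional K M] {S : DiffModule K (sigma q) M}
    {ρ : RootSystem q} {l : ℕ+}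
    {n : ℕ} {b : Module.Basis (Fin n) (Ramified l) (Ramified l ⊗[K] M)} {a : Fin n → Ramified l}
    (h : (S.baseChange ρ l).IsTriangular b a) (μ : ℚ) : Module.finrank K (S.part μ) ≤
      Nat.card {j : Fin n // (val l (a j) : ℚ) / ((l : ℕ) : ℚ) = μ} := by
  refine (finrank_slopePart_le_baseChange S ρ l _).trans
    ((h.finrank_slopePart_le (Real.exp_pos _)).trans (le_of_eq ?_))
  refine Nat.card_congr (Equiv.subtypeEquivRight fun j => ?_)
  rw [ramAbs_apply ρ l (h j).1, Real.exp_eq_exp, neg_inj, Rat.cast_inj]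

theorem IsTriangular.finrank_part_eq_and_iSupIndep [FiniteDimensional K M]
    {S : DiffModule K (sigma q) M} {ρ : RootSystem q} {l : ℕ+}
    {n : ℕ} {b : Module.Basis (Fin n) (Ramified l) (Ramified l ⊗[K] M)} {a : Fin n → Ramified l}
    (h : (S.baseChange ρ l).IsTriangular b a) : (∀ μ, Module.finrank K (S.part μ) =
      Nat.card {j : Fin n // (val l (a j) : ℚ) / ((l : ℕ) : ℚ) = μ}) ∧ iSupIndep S.part := by
  classical
  have hn : Module.finrank K M = n := by
    have h1 := Module.finrank_eq_card_basis b
    have h2 := Module.finrank_eq_card_basis ((Module.finBasis K M).baseChange (Ramified l))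
    rw [Fintype.card_fin] at h1 h2
    omega
  refine finrank_eq_and_iSupIndep_of_le S.part _
    (Finset.univ.image fun j => (val l (a j) : ℚ) / ((l : ℕ) : ℚ)) h.finrank_part_le ?_
    h.iSup_part_eq_top ?_
  · intro μ hμ
    rw [Nat.card_eq_zero]
    exact Or.inl ⟨fun j => hμ (Finset.mem_image.2 ⟨j.1, Finset.mem_univ _, j.2⟩)⟩
  · rw [hn]
    conv_rhs => rw [← Fintype.card_fin n, ← Finset.card_univ]
    rw [Finset.card_eq_sum_card_fiberwise (f := fun j => (val l (a j) : ℚ) / ((l : ℕ) : ℚ))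
      (fun j hj => Finset.mem_coe.2 (Finset.mem_image_of_mem _ hj))]
    refine Finset.sum_congr rfl fun μ _ => ?_
    rw [Nat.card_eq_fintype_card, Fintype.card_subtype]

theorem part_restrict (S : DiffModule K (sigma q) M) {N : Submodule K M} (hN : S.IsStable N) (μ : ℚ) :
    (S.restrict N hN).part μ = (S.part μ).comap N.subtype :=
  restrict_slopePart hN _

section Slopes

variable [FiniteDimensional K M] (S : DiffModule K (sigma q) M) (ρ : RootSystem q)

/-- Every triangularization counts the dimension of the same intrinsic subspace, so the choice made
in `newtonFunction` is immaterial. -/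
theorem newtonFunction_eq (hq : 1 < ‖(q : ℂ)‖) (μ : ℚ) :
    S.newtonFunction ρ μ = Module.finrank K (S.part μ) := by
  have hex : ∃ r, S.HasNewtonFunction ρ r := by
    obtain ⟨l, n, b, a, h⟩ := S.exists_isTriangular hq ρ
    exact ⟨_, l, n, b, a, h, fun _ => rfl⟩
  rw [newtonFunction, dif_pos hex]
  obtain ⟨l, n, b, a, h, hr⟩ := hex.choose_spec
  rw [hr, h.finrank_part_eq_and_iSupIndep.1]

variable {ρ}

theorem iSup_part (hq : 1 < ‖(q : ℂ)‖) (ρ : RootSystem q) : ⨆ μ, S.part μ = ⊤ := by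
  obtain ⟨l, n, b, a, h⟩ := S.exists_isTriangular hq ρ
  exact h.iSup_part_eq_top

theorem iSupIndep_part (hq : 1 < ‖(q : ℂ)‖) (ρ : RootSystem q) : iSupIndep S.part := by
  obtain ⟨l, n, b, a, h⟩ := S.exists_isTriangular hq ρ
  exact h.finrank_part_eq_and_iSupIndep.2

theorem mem_slopes (hq : 1 < ‖(q : ℂ)‖) {μ : ℚ} : μ ∈ S.slopes ρ ↔ S.part μ ≠ ⊥ := by
  rw [slopes, Function.mem_support, S.newtonFunction_eq ρ hq, Ne, Submodule.finrank_eq_zero]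

theorem finite_slopes (hq : 1 < ‖(q : ℂ)‖) : (S.slopes ρ).Finite := by
  have : S.slopes ρ = {μ | S.part μ ≠ ⊥} := Set.ext fun μ => S.mem_slopes hq
  rw [this]
  exact WellFoundedGT.finite_ne_bot_of_iSupIndep (S.iSupIndep_part hq ρ)

theorem isPure_part (hq : 1 < ‖(q : ℂ)‖) {μ : ℚ} (h : S.part μ ≠ ⊥) :
    (S.restrict _ (S.isStable_part μ)).IsPure ρ μ := by
  ext ν
  rw [mem_slopes _ hq, part_restrict, Set.mem_singleton_iff]
  constructor
  · intro hne
    by_contra hν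
    apply hne
    rw [eq_bot_iff]
    intro x hx
    have hd := (S.iSupIndep_part hq ρ).pairwiseDisjoint hν
    exact (Submodule.mem_bot K).2 (Subtype.ext (Submodule.disjoint_def.1 hd x hx x.2))
  · rintro rfl
    rw [Submodule.comap_subtype_self]
    intro h'
    rw [Submodule.eq_bot_iff] at h'
    exact h (eq_bot_iff.2 fun x hx =>
      (Submodule.mem_bot K).2 (congrArg Subtype.val (h' ⟨x, hx⟩ trivial)))

/-- `N` is the sum of its own slope parts, and purity leaves only the one of slope `μ`. -/
theorem IsPure.le_part {S : DiffModule K (sigma q) M} (hq : 1 < ‖(q : ℂ)‖) {N : Submodule K M} {hN : S.IsStable N} {μ : ℚ}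
    (h : (S.restrict N hN).IsPure ρ μ) : N ≤ S.part μ := by
  have htop : (S.restrict N hN).part μ = ⊤ := by
    rw [eq_top_iff, ← (S.restrict N hN).iSup_part hq ρ]
    refine iSup_le fun ν => ?_
    by_cases hν : ν = μ
    · rw [hν]
    · have : ν ∉ (S.restrict N hN).slopes ρ := by
        rw [h]; exact hν
      rw [mem_slopes _ hq, not_not] at this
      rw [this]
      exact bot_le
  rw [part_restrict, Submodule.comap_subtype_eq_top] at htop
  exact htop

end Slopes

theorem IsPure.ne_bot {ρ : RootSystem q} {S : DiffModule K (sigma q) M} (hq : 1 < ‖(q : ℂ)‖) {N : Submodule K M} {hN : S.IsStable N} {μ : ℚ}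
    (h : (S.restrict N hN).IsPure ρ μ) : N ≠ ⊥ := by
  rintro rfl
  have : μ ∈ (S.restrict ⊥ hN).slopes ρ := by rw [h]; rfl
  rw [mem_slopes _ hq] at this
  exact this (Subsingleton.elim _ _)

theorem isPureDecomposition_part [FiniteDimensional K M] (S : DiffModule K (sigma q) M)
    (hq : 1 < ‖(q : ℂ)‖) (ρ : RootSystem q) :
    S.IsPureDecomposition ρ (ι := S.slopes ρ) (fun μ => (μ : ℚ)) fun μ => S.part μ where
  injective := Subtype.val_injective
  stable μ := S.isStable_part μ
  pure μ := S.isPure_part hq ((S.mem_slopes hq).1 μ.2)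
  independent := (S.iSupIndep_part hq ρ).comp Subtype.val_injective
  iSup_eq_top := by
    rw [eq_top_iff, ← S.iSup_part hq ρ]
    refine iSup_le fun μ => ?_
    by_cases h : μ ∈ S.slopes ρ
    · exact le_iSup (fun μ : S.slopes ρ => S.part μ) ⟨μ, h⟩
    · rw [mem_slopes _ hq, not_not] at h
      rw [h]
      exact bot_le

/-- Write `x` in `p i` as an element of `p' i` plus one of the sum of the other `p j`; the latter
also lies in `p i`, hence is zero. -/
theorem eq_of_le_of_iSupIndep {R : Type u} [Ring R] {V : Type v} [AddCommGroup V] [Module R V]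
    {ι : Type*} {p p' : ι → Submodule R V} (hle : ∀ i, p' i ≤ p i) (hp : iSupIndep p)
    (htop : ⨆ i, p' i = ⊤) (i : ι) : p' i = p i := by
  refine le_antisymm (hle i) fun x hx => ?_
  have hsup : p' i ⊔ ⨆ (j) (_ : j ≠ i), p j = ⊤ := by
    rw [eq_top_iff, ← htop]
    refine iSup_le fun j => ?_
    by_cases hj : j = i
    · rw [hj]; exact le_sup_left
    · exact (hle j).trans ((le_iSup₂ (f := fun j (_ : j ≠ i) => p j) j hj).trans le_sup_right)
  obtain ⟨y, hy, z, hz, rfl⟩ := Submodule.mem_sup.1 (hsup ▸ Submodule.mem_top : x ∈ _)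
  have hz' : z ∈ p i := by
    have := sub_mem hx (hle i hy)
    rwa [add_sub_cancel_left] at this
  rw [Submodule.disjoint_def.1 (hp i) z hz' hz, add_zero]
  exact hy

theorem IsPureDecomposition.exists_equiv [FiniteDimensional K M] {S : DiffModule K (sigma q) M}
    (hq : 1 < ‖(q : ℂ)‖) {ρ : RootSystem q} {ι : Type} {ν : ι → ℚ} {N : ι → Submodule K M}
    (h : S.IsPureDecomposition ρ ν N) :
    ∃ e : ι ≃ S.slopes ρ, ∀ i, (e i : ℚ) = ν i ∧ N i = S.part (e i) := by
  have hle : ∀ i, N i ≤ S.part (ν i) := fun i => IsPure.le_part hq (h.pure i)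
  have hne : ∀ i, S.part (ν i) ≠ ⊥ := fun i hi =>
    IsPure.ne_bot hq (h.pure i) (eq_bot_iff.2 (hi ▸ hle i))
  refine ⟨Equiv.ofBijective (fun i => ⟨ν i, (S.mem_slopes hq).2 (hne i)⟩)
    ⟨fun i j hij => h.injective (congrArg Subtype.val hij), ?_⟩, fun i => ⟨rfl, ?_⟩⟩
  · rintro ⟨μ, hμ⟩
    -- If `μ` were missed, all summands would lie in the sum of the other parts; that sum would be
    -- everything while being disjoint from the nonzero part of slope `μ`.
    by_contra! hμ'
    rw [S.mem_slopes hq] at hμ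
    apply hμ
    have hd := S.iSupIndep_part hq ρ μ
    have : ⨆ (ν') (_ : ν' ≠ μ), S.part ν' = ⊤ := by
      rw [eq_top_iff, ← h.iSup_eq_top]
      refine iSup_le fun i => (hle i).trans ?_
      exact le_iSup₂ (f := fun ν' (_ : ν' ≠ μ) => S.part ν') (ν i)
        fun hi => hμ' i (Subtype.ext hi)
    rwa [this, disjoint_top] at hd
  · exact eq_of_le_of_iSupIndep hle ((S.iSupIndep_part hq ρ).comp h.injective) h.iSup_eq_top i

end DiffModule

end QDiff

end

theorem mainTheorem5 (q : ℂˣ) (hq : 1 < ‖(q : ℂ)‖) (ρ : QDiff.RootSystem q)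
    (M : Type*) [AddCommGroup M] [Module QDiff.K M] [FiniteDimensional QDiff.K M]
    (S : QDiff.DiffModule QDiff.K (QDiff.sigma q) M) :
    (S.slopes ρ).Finite ∧
    ∃ N : S.slopes ρ → Submodule QDiff.K M,
      S.IsPureDecomposition ρ (fun μ : S.slopes ρ => (μ : ℚ)) N ∧
      (∀ μ, Module.finrank QDiff.K (N μ) = S.newtonFunction ρ μ) ∧
      ∀ (ι : Type) (ν : ι → ℚ) (N' : ι → Submodule QDiff.K M),
        S.IsPureDecomposition ρ ν N' →
          ∃ e : ι ≃ S.slopes ρ, ∀ i, (e i : ℚ) = ν i ∧ N' i = N (e i) :=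
  ⟨S.finite_slopes hq, fun μ => S.part μ, S.isPureDecomposition_part hq ρ,
    fun μ => (S.newtonFunction_eq ρ hq μ).symm, fun _ _ _ h => h.exists_equiv hq⟩
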